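/- Let $n>2$ and $m\ge 0$ be integers, let $V=\{a\in\mathbb{R}^n : a_1+\dots+a_n=0\}$, and for $\alpha=\epsilon_i-\epsilon_j$ with $i\ne j$ and $k\in\mathbb{Z}$ let $H_{\alpha,k}=\{v\in V : \langle v\,|\,\alpha\rangle=k\}$; the root $\alpha=\epsilon_i-\epsilon_j$ is positive if $i<j$. Let $\mathcal{S}_{n,m}$ be the $m$-Shi arrangement, consisting of all $H_{\alpha,k}$ with $\alpha$ positive and $-m<k\le m$; its regions are the connected components of the complement in $V$ of the union of its hyperplanes. Let $\widetilde S_n$ be the affine symmetric group, with Coxeter generators $s_0,\dots,s_{n-1}$ and length function $\ell$, acting on $V$ so that $s_i$ swaps the $i$-th and $(i+1)$-st coordinates for $1\le i\le n-1$, and $s_0(a_1,\dots,a_n)=(a_n+1,a_2,\dots,a_{n-1},a_1-1)$. The symmetric group $S_n$ is identified with the subgroup $\langle s_1,\dots,s_{n-1}\rangle$. Let $A_0=\{v\in V : v_1\ge v_2\ge\dots\ge v_n,\ v_1-v_n\le 1\}$ be the fundamental alcove; the alcoves are the sets $wA_0$ with $w\in\widetilde S_n$. An alcove $wA_0$ is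 dominant if it is contained in $\{v\in V : v_1\ge\dots\ge v_n\}$. It is $m$-maximal if its interior lies in a bounded region $R$ of $\mathcal{S}_{n,m}$ and $\ell(w)$ is maximal among all $w'\in\widetilde S_n$ such that the interior of $w'A_0$ lies in $R$. A ceiling of an alcove is a hyperplane $H_{\alpha,k}$ that does not contain the origin, contains a facet of the alcove, and has the alcove and the origin on the same side. Let $w\in\widetilde S_n$ be such that $wA_0$ is dominant and $m$-maximal. Let $X\subseteq S_n$ be the set of reflections (transpositions) $s_\alpha$, where $\alpha$ runs over the positive roots such that $H_{\alpha,m}$ is a ceiling of $wA_0$, and let $$G^X=\{\rho\in S_n : \ell(\rho x)>\ell(\rho)\text{ for all }x\in X\}.$$ Let $\rho\in S_n$. Then $\rho wA_0$ is $m$-maximal if and only if $\rho\in G^X$. -/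

import Mathlib

open scoped Topology

noncomputable section

namespace ShiAlcove

/-! ### The affine symmetric group -/

/-- The residue in `{0, …, n-1}` of an integer modulo `n`. -/
def res (n : ℕ) [NeZero n] (x : ℤ) : Fin n :=
  ⟨(x % n).toNat, by
    have hn : (0 : ℤ) < n := by exact_mod_cast Nat.pos_of_neZero n
    have h1 := Int.emod_nonneg x hn.ne'
    have h2 := Int.emod_lt_of_pos x hn
    omega⟩

theorem res_val (n : ℕ) [NeZero n] (x : ℤ) : ((res n x : ℕ) : ℤ) = x % n := by
  have hn : (0 : ℤ) < n := by exact_mod_cast Nat.pos_of_neZero n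
  exact Int.toNat_of_nonneg (Int.emod_nonneg x hn.ne')

theorem res_eq_iff (n : ℕ) [NeZero n] (x y : ℤ) :
    res n x = res n y ↔ ∃ k : ℤ, x = y + k * n := by
  rw [Fin.ext_iff, ← Int.natCast_inj, res_val, res_val]
  constructor
  · intro h
    refine ⟨x / n - y / n, ?_⟩
    have h1 := Int.emod_add_mul_ediv x n
    have h2 := Int.emod_add_mul_ediv y n
    linear_combination h2 - h1 + h
  · rintro ⟨k, rfl⟩
    simp

theorem res_natCast (n : ℕ) [NeZero n] (i : Fin n) : res n ((i : ℕ) : ℤ) = i := by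
  rw [Fin.ext_iff, ← Int.natCast_inj, res_val]
  exact Int.emod_eq_of_lt (by positivity) (by exact_mod_cast i.isLt)

/-- `φ (x + n) = φ x + n` for all integers `x`. -/
def IsShiftEquivariant (n : ℕ) (φ : Equiv.Perm ℤ) : Prop := ∀ x : ℤ, φ (x + n) = φ x + n

theorem IsShiftEquivariant.add_mul {n : ℕ} {φ : Equiv.Perm ℤ} (h : IsShiftEquivariant n φ)
    (x k : ℤ) : φ (x + k * n) = φ x + k * n := by
  induction k using Int.induction_on with
  | zero => simp
  | succ k ih =>
    have := h (x + k * n)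
    rw [ih] at this
    rw [show x + ((k : ℤ) + 1) * n = x + k * n + n by ring, this]; ring
  | pred k ih =>
    have := h (x + (-(k : ℤ) - 1) * n)
    rw [show x + (-(k : ℤ) - 1) * n + n = x + (-(k : ℤ)) * n by ring, ih] at this
    linear_combination -this

theorem IsShiftEquivariant.inv {n : ℕ} {φ : Equiv.Perm ℤ} (h : IsShiftEquivariant n φ) :
    IsShiftEquivariant n φ⁻¹ := by
  intro x
  apply φ.injective
  rw [h]
  simp

theorem res_bijective {n : ℕ} [NeZero n] {φ : Equiv.Perm ℤ} (h : IsShiftEquivariant n φ) :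
    Function.Bijective (fun i : Fin n => res n (φ ((i : ℕ) : ℤ))) := by
  refine Finite.injective_iff_bijective.1 fun i j hij => ?_
  obtain ⟨k, hk⟩ := (res_eq_iff n _ _).1 hij
  rw [← h.add_mul] at hk
  have := (res_eq_iff n _ _).2 ⟨k, φ.injective hk⟩
  rwa [res_natCast, res_natCast] at this

theorem sum_comp_res {n : ℕ} [NeZero n] {φ : Equiv.Perm ℤ} (h : IsShiftEquivariant n φ)
    {M : Type*} [AddCommMonoid M] (f : Fin n → M) :
    ∑ i : Fin n, f (res n (φ ((i : ℕ) : ℤ))) = ∑ i : Fin n, f i :=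
  Function.Bijective.sum_comp (res_bijective h) f

theorem sum_ediv {n : ℕ} [NeZero n] {φ : Equiv.Perm ℤ} (h : IsShiftEquivariant n φ)
    (hs : ∑ i : Fin n, φ ((i : ℕ) : ℤ) = ∑ i : Fin n, ((i : ℕ) : ℤ)) :
    ∑ i : Fin n, φ ((i : ℕ) : ℤ) / n = 0 := by
  have hn : (n : ℤ) ≠ 0 := by exact_mod_cast NeZero.ne n
  have h1 := sum_comp_res h (fun i => ((i : ℕ) : ℤ))
  rw [← hs] at h1
  simp only [res_val] at h1
  have h2 : ∑ i : Fin n, φ ((i : ℕ) : ℤ) =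
      ∑ i : Fin n, φ ((i : ℕ) : ℤ) % n + n * ∑ i : Fin n, φ ((i : ℕ) : ℤ) / n := by
    rw [Finset.mul_sum, ← Finset.sum_add_distrib]
    exact Finset.sum_congr rfl fun i _ => (Int.emod_add_mul_ediv _ _).symm
  have h3 : (n : ℤ) * ∑ i : Fin n, φ ((i : ℕ) : ℤ) / n = 0 := by linarith
  exact (mul_eq_zero.1 h3).resolve_left hn

theorem sum_comp {n : ℕ} [NeZero n] {φ ψ : Equiv.Perm ℤ} (hφ : IsShiftEquivariant n φ)
    (hψ : IsShiftEquivariant n ψ)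
    (hs : ∑ i : Fin n, ψ ((i : ℕ) : ℤ) = ∑ i : Fin n, ((i : ℕ) : ℤ)) :
    ∑ i : Fin n, φ (ψ ((i : ℕ) : ℤ)) = ∑ i : Fin n, φ ((i : ℕ) : ℤ) := by
  have h1 : ∀ x : ℤ, φ x = φ ((res n x : ℕ) : ℤ) + x / n * n := by
    intro x
    rw [← hφ.add_mul, res_val, mul_comm, Int.emod_add_mul_ediv]
  have h2 : ∀ i : Fin n, φ (ψ ((i : ℕ) : ℤ)) =
      φ ((res n (ψ ((i : ℕ) : ℤ)) : ℕ) : ℤ) + ψ ((i : ℕ) : ℤ) / n * n := fun i => h1 _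
  rw [Finset.sum_congr rfl fun i _ => h2 i, Finset.sum_add_distrib, ← Finset.sum_mul,
    sum_ediv hψ hs, sum_comp_res hψ (fun i => φ ((i : ℕ) : ℤ))]
  simp

/-- The affine symmetric group: permutations `φ` of `ℤ` with `φ (x + n) = φ x + n` and
`φ 0 + ⋯ + φ (n-1) = 0 + ⋯ + (n-1)`. -/
def affineSymm (n : ℕ) [NeZero n] : Subgroup (Equiv.Perm ℤ) where
  carrier := {φ | (∀ x : ℤ, φ (x + n) = φ x + n) ∧
    ∑ i : Fin n, φ ((i : ℕ) : ℤ) = ∑ i : Fin n, ((i : ℕ) : ℤ)}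
  one_mem' := by simp
  mul_mem' := by
    rintro φ ψ ⟨hφ, hsφ⟩ ⟨hψ, hsψ⟩
    refine ⟨fun x => by simp [hφ, hψ], ?_⟩
    rw [← hsφ, ← sum_comp hφ hψ hsψ]
    rfl
  inv_mem' := by
    rintro φ ⟨hφ, hsφ⟩
    have h := IsShiftEquivariant.inv hφ
    refine ⟨h, ?_⟩
    rw [← sum_comp h hφ hsφ]
    simp

/-- The generators `s_0, …, s_{n-1}`: `s_i` adds `1` to the integers congruent to `i - 1` modulo
`n`, subtracts `1` from those congruent to `i`, and fixes all others. -/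
def affineSimple (n : ℕ) [NeZero n] : Set (affineSymm n) :=
  {s | ∃ i : ℤ, ∀ x : ℤ, (s : Equiv.Perm ℤ) x =
    if x ≡ i - 1 [ZMOD n] then x + 1 else if x ≡ i [ZMOD n] then x - 1 else x}

/-- The adjacent transpositions of the symmetric group. -/
def finiteSimple (n : ℕ) : Set (Equiv.Perm (Fin n)) :=
  {s | ∃ i j : Fin n, (i : ℕ) + 1 = j ∧ s = Equiv.swap i j}

/-- The length of `g` with respect to a set `S` of involutions generating the group: the least
`k` such that `g` is a product of `k` elements of `S`. -/
def wordLength {Γ : Type*} [Group Γ] (S : Set Γ) (g : Γ) : ℕ :=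
  sInf {k | ∃ l : List Γ, l.length = k ∧ (∀ s ∈ l, s ∈ S) ∧ l.prod = g}

/-- The inclusion of the finite symmetric group as the subgroup `⟨s_1, …, s_{n-1}⟩`: the affine
permutation `r + q n ↦ ρ r + q n` for `0 ≤ r < n`. -/
def finEmb {n : ℕ} [NeZero n] (ρ : Equiv.Perm (Fin n)) : affineSymm n :=
  ⟨{ toFun := fun x => ((ρ (res n x) : ℕ) : ℤ) + x / n * n
     invFun := fun x => ((ρ.symm (res n x) : ℕ) : ℤ) + x / n * n
     left_inv := by
      intro x
      have hn : (n : ℤ) ≠ 0 := by exact_mod_cast NeZero.ne n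
      have h1 : res n (((ρ (res n x) : ℕ) : ℤ) + x / n * n) = ρ (res n x) := by
        rw [(res_eq_iff n _ ((ρ (res n x) : ℕ) : ℤ)).2 ⟨_, rfl⟩, res_natCast]
      have h2 : (((ρ (res n x) : ℕ) : ℤ) + x / n * n) / n = x / n := by
        rw [Int.add_mul_ediv_right _ _ hn, Int.ediv_eq_zero_of_lt (by positivity)
          (by exact_mod_cast (ρ (res n x)).isLt), zero_add]
      simp only [h1, h2, Equiv.symm_apply_apply, res_val]
      rw [mul_comm, Int.emod_add_mul_ediv]
     right_inv := by
      intro x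
      have hn : (n : ℤ) ≠ 0 := by exact_mod_cast NeZero.ne n
      have h1 : res n (((ρ.symm (res n x) : ℕ) : ℤ) + x / n * n) = ρ.symm (res n x) := by
        rw [(res_eq_iff n _ ((ρ.symm (res n x) : ℕ) : ℤ)).2 ⟨_, rfl⟩, res_natCast]
      have h2 : (((ρ.symm (res n x) : ℕ) : ℤ) + x / n * n) / n = x / n := by
        rw [Int.add_mul_ediv_right _ _ hn, Int.ediv_eq_zero_of_lt (by positivity)
          (by exact_mod_cast (ρ.symm (res n x)).isLt), zero_add]
      simp only [h1, h2, Equiv.apply_symm_apply, res_val]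
      rw [mul_comm, Int.emod_add_mul_ediv] },
   by
    have hn : (n : ℤ) ≠ 0 := by exact_mod_cast NeZero.ne n
    refine ⟨fun x => ?_, ?_⟩
    · have h1 : res n (x + n) = res n x := (res_eq_iff n _ _).2 ⟨1, by ring⟩
      have h2 : (x + n) / n = x / n + 1 := by
        simpa using Int.add_mul_ediv_right x 1 hn
      simp only [Equiv.coe_fn_mk, h1, h2]
      ring
    · have h2 : ∀ i : Fin n, ((i : ℕ) : ℤ) / n = 0 := fun i =>
        Int.ediv_eq_zero_of_lt (by positivity) (by exact_mod_cast i.isLt)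
      simp only [Equiv.coe_fn_mk, res_natCast, h2, zero_mul, add_zero]
      exact Equiv.sum_comp ρ (fun i => ((i : ℕ) : ℤ))⟩

/-! ### The space `V` and the action of the affine symmetric group -/

/-- The vectors of `ℝⁿ` whose coordinates sum to zero. -/
def V (n : ℕ) : Submodule ℝ (EuclideanSpace ℝ (Fin n)) where
  carrier := {v | ∑ i, v i = 0}
  zero_mem' := by simp
  add_mem' := by
    intro v w hv hw
    simp only [Set.mem_ofPred_eq] at hv hw ⊢
    simp [Finset.sum_add_distrib, hv, hw]
  smul_mem' := by
    intro c v hv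
    simp only [Set.mem_ofPred_eq] at hv ⊢
    simp [← Finset.mul_sum, hv]

/-- The extension of a vector `(a_0, …, a_{n-1})` to a sequence indexed by `ℤ` that satisfies
`a_{x+n} = a_x - 1`. -/
def extend {n : ℕ} [NeZero n] (a : V n) (x : ℤ) : ℝ :=
  (a : EuclideanSpace ℝ (Fin n)) (res n x) - ((x / n : ℤ) : ℝ)

theorem extend_natCast {n : ℕ} [NeZero n] (a : V n) (i : Fin n) :
    extend a ((i : ℕ) : ℤ) = (a : EuclideanSpace ℝ (Fin n)) i := by
  have h : ((i : ℕ) : ℤ) / n = 0 :=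
    Int.ediv_eq_zero_of_lt (by positivity) (by exact_mod_cast i.isLt)
  simp [extend, res_natCast, h]

theorem extend_add_mul {n : ℕ} [NeZero n] (a : V n) (x k : ℤ) :
    extend a (x + k * n) = extend a x - k := by
  have hn : (n : ℤ) ≠ 0 := by exact_mod_cast NeZero.ne n
  have h1 : res n (x + k * n) = res n x := (res_eq_iff n _ _).2 ⟨k, rfl⟩
  simp only [extend, h1, Int.add_mul_ediv_right x k hn]
  push_cast
  ring

/-- The vector `w • a`, whose coordinate in position `r` is the entry of the extended sequence
of `a` at `w⁻¹ r`. -/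
def act {n : ℕ} [NeZero n] (w : affineSymm n) (a : V n) : V n :=
  ⟨WithLp.toLp 2 fun r : Fin n => extend a ((w : Equiv.Perm ℤ)⁻¹ ((r : ℕ) : ℤ)), by
    have h : IsShiftEquivariant n (w : Equiv.Perm ℤ)⁻¹ := (w⁻¹).2.1
    have hs : ∑ i : Fin n, (w : Equiv.Perm ℤ)⁻¹ ((i : ℕ) : ℤ) = ∑ i : Fin n, ((i : ℕ) : ℤ) :=
      (w⁻¹).2.2
    change ∑ r : Fin n, extend a ((w : Equiv.Perm ℤ)⁻¹ ((r : ℕ) : ℤ)) = 0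
    have ha : ∑ i, (a : EuclideanSpace ℝ (Fin n)) i = 0 := a.2
    simp only [extend, Finset.sum_sub_distrib]
    rw [sum_comp_res h (fun i => (a : EuclideanSpace ℝ (Fin n)) i), ha, ← Int.cast_sum,
      sum_ediv h hs]
    simp⟩

theorem extend_act {n : ℕ} [NeZero n] (w : affineSymm n) (a : V n) (x : ℤ) :
    extend (act w a) x = extend a ((w : Equiv.Perm ℤ)⁻¹ x) := by
  have h : IsShiftEquivariant n (w : Equiv.Perm ℤ)⁻¹ := (w⁻¹).2.1
  have hx : x = ((res n x : ℕ) : ℤ) + x / n * n := by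
    rw [res_val, mul_comm, Int.emod_add_mul_ediv]
  rw [hx, extend_add_mul, extend_natCast, h.add_mul, extend_add_mul]
  rfl

theorem extend_injective {n : ℕ} [NeZero n] {a b : V n} (h : ∀ x, extend a x = extend b x) :
    a = b := by
  ext i
  rw [← extend_natCast a, h, extend_natCast]

/-- The action of the affine symmetric group on `V`. The generator `s_i` with `1 ≤ i ≤ n - 1`
swaps the `i`-th and `(i+1)`-st of the coordinates `(a_1, …, a_n)`, and `s_0` sends
`(a_1, …, a_n)` to `(a_n + 1, a_2, …, a_{n-1}, a_1 - 1)`. -/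
instance (n : ℕ) [NeZero n] : MulAction (affineSymm n) (V n) where
  smul := act
  one_smul a := extend_injective fun x => by
    change extend (act 1 a) x = _
    rw [extend_act]
    simp
  mul_smul w w' a := extend_injective fun x => by
    change extend (act (w * w') a) x = extend (act w (act w' a)) x
    rw [extend_act, extend_act, extend_act]
    simp

/-! ### Roots, hyperplanes, regions, alcoves -/

/-- The root `ε_i - ε_j`. -/
def root {n : ℕ} (i j : Fin n) : EuclideanSpace ℝ (Fin n) :=
  EuclideanSpace.single i 1 - EuclideanSpace.single j 1

/-- The hyperplane `H_{α,k}` in `V`. -/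
def hyperplane {n : ℕ} (α : EuclideanSpace ℝ (Fin n)) (k : ℤ) : Set (V n) :=
  {v | inner ℝ (v : EuclideanSpace ℝ (Fin n)) α = (k : ℝ)}

/-- The closed half-space `H_{α,k}⁺`. -/
def upperHalf {n : ℕ} (α : EuclideanSpace ℝ (Fin n)) (k : ℤ) : Set (V n) :=
  {v | (k : ℝ) ≤ inner ℝ (v : EuclideanSpace ℝ (Fin n)) α}

/-- The closed half-space `H_{α,k}⁻`. -/
def lowerHalf {n : ℕ} (α : EuclideanSpace ℝ (Fin n)) (k : ℤ) : Set (V n) :=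
  {v | inner ℝ (v : EuclideanSpace ℝ (Fin n)) α ≤ (k : ℝ)}

/-- The `m`-Shi arrangement: all `H_{α,k}` with `α` a positive root and `-m < k ≤ m`. -/
def shiArrangement (n m : ℕ) : Set (Set (V n)) :=
  {H | ∃ i j : Fin n, i < j ∧ ∃ k : ℤ, -(m : ℤ) < k ∧ k ≤ m ∧ H = hyperplane (root i j) k}

/-- A region of an arrangement: a connected component of the complement of its union. -/
def IsRegion {n : ℕ} (𝓗 : Set (Set (V n))) (R : Set (V n)) : Prop :=
  ∃ v ∈ (⋃₀ 𝓗)ᶜ, R = connectedComponentIn (⋃₀ 𝓗)ᶜ v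

/-- The (closed) dominant chamber: the intersection of the `H_{α,0}⁺` over the simple roots. -/
def dominantChamber (n : ℕ) : Set (V n) :=
  ⋂ (i : Fin n) (j : Fin n) (_ : (i : ℕ) + 1 = j), upperHalf (root i j) 0

/-- The (closed) fundamental alcove: the part of the dominant chamber in `H_{θ,1}⁻`, where
`θ = ε_1 - ε_n` is the highest root. -/
def fundamentalAlcove (n : ℕ) [NeZero n] : Set (V n) :=
  dominantChamber n ∩ lowerHalf (root 0 (Fin.rev 0)) 1

/-- The (closed) alcove `w A_0`. -/
def alcove {n : ℕ} [NeZero n] (w : affineSymm n) : Set (V n) :=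
  (fun v => w • v) '' fundamentalAlcove n

/-- The alcove `w A_0` lies in the region `R`. As regions are open and alcoves are closed, this
means that the interior of the alcove is contained in `R`. -/
def AlcoveIn {n : ℕ} [NeZero n] (w : affineSymm n) (R : Set (V n)) : Prop :=
  interior (alcove w) ⊆ R

/-- The alcove `w A_0` is dominant. -/
def IsDominant {n : ℕ} [NeZero n] (w : affineSymm n) : Prop :=
  alcove w ⊆ dominantChamber n

/-- The alcove `w A_0` is `m`-maximal: it lies in a bounded region of the `m`-Shi arrangement,
and `w` has maximal length among all `w'` such that `w' A_0` lies in that region. -/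
def IsMaximal {n : ℕ} [NeZero n] (m : ℕ) (w : affineSymm n) : Prop :=
  ∃ R, IsRegion (shiArrangement n m) R ∧ Bornology.IsBounded R ∧ AlcoveIn w R ∧
    ∀ w' : affineSymm n, AlcoveIn w' R →
      wordLength (affineSimple n) w' ≤ wordLength (affineSimple n) w

/-- The hyperplane `H` is a wall of the alcove `A`: it contains a facet of `A`, that is, a part
of the boundary of `A` which has nonempty interior relative to `H`. -/
def IsWall {n : ℕ} (A H : Set (V n)) : Prop :=
  ∃ x ∈ H, frontier A ∈ 𝓝[H] x

/-- `H_{α,k}` is a ceiling of the alcove `A`: it is a wall of `A`, does not pass through the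
origin, and has `A` and the origin on the same side. -/
def IsCeiling {n : ℕ} (A : Set (V n)) (α : EuclideanSpace ℝ (Fin n)) (k : ℤ) : Prop :=
  IsWall A (hyperplane α k) ∧ (0 : V n) ∉ hyperplane α k ∧
    (insert 0 A ⊆ upperHalf α k ∨ insert 0 A ⊆ lowerHalf α k)

/-- The set `X` of all reflections `s_α`, with `α` a positive root such that `H_{α,m}` is a
ceiling of `w A_0`. For `α = ε_i - ε_j` the reflection `s_α` is the transposition `(i j)`. -/
def ceilingReflections {n : ℕ} [NeZero n] (m : ℕ) (w : affineSymm n) :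
    Set (Equiv.Perm (Fin n)) :=
  {x | ∃ i j : Fin n, i < j ∧ IsCeiling (alcove w) (root i j) m ∧ x = Equiv.swap i j}

/-- The set `G^X` of all `ρ` in the symmetric group with `ℓ(ρ x) > ℓ(ρ)` for all `x ∈ X`. -/
def minimalReps {n : ℕ} (X : Set (Equiv.Perm (Fin n))) : Set (Equiv.Perm (Fin n)) :=
  {ρ | ∀ x ∈ X, wordLength (finiteSimple n) ρ < wordLength (finiteSimple n) (ρ * x)}

end ShiAlcove

end

open scoped Topology

noncomputable section

namespace ShiAlcove

/-! ### Word length from a statistic on the group -/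

/-! An alcove `w A_0` is encoded by the integers `K i j = ⌊v_i - v_j⌋`, for `v` in its interior, and
these can be read off from `w⁻¹` (`shiTable`). The length of `w` is the sum of `|K i j|` over `i <
j` (`wordLength_affineSimple`), and left multiplication by `ρ` only relabels the entries
(`shiTable_finEmb_mul`). For dominant `w` and `a < b` the entry `K a b` is nonnegative, and it
contributes `K a b` to the length of `ρ w` if `ρ a < ρ b`, and `K a b + 1` otherwise. So larger
entries always mean greater length.

Raising `K a b` by one crosses a hyperplane of the arrangement exactly when `K a b < m` if `ρ a < ρ
b`, but only when `K a b < m - 1` if `ρ b < ρ a`, because the range `-m < k ≤ m` is not symmetric.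
The two cases differ only at `K a b = m - 1`, the value at a ceiling of height `m`.

Necessity: crossing a ceiling raises one entry and changes no other pair (`exists_crossing`). If the
crossed hyperplane is not in the arrangement, a longer element appears in the same region.
Maximality of `ρ w` therefore forces `K a b < m` at every ceiling of `w`, and `ρ a < ρ b` when `K a
b = m - 1` (`shiTable_lt_of_isMaximal`). By `wordLength_lt_mul_swap_iff` the second condition is
membership in `G^X`.

Sufficiency: the same conditions at the ceilings control the whole table. A pair with no ceiling
directly above it has an entry tied to those of other pairs (`ceiling_or_isBounded`), and an
induction shows that every point of the region of `ρ w A_0`, moved back by `ρ`, has table at most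
`K` (`IsShiTable.le_of_le_at_ceilings`). This gives both boundedness of the region and maximality of
the length (`isMaximal_finEmb_mul`). -/

/-- Stripping descents one at a time writes `g` with at most `N g` generators, and no word can be
shorter because each letter raises `N` by at most one. This serves both the finite and the affine
group. -/
theorem wordLength_eq {Γ : Type*} [Group Γ] {S : Set Γ} {N : Γ → ℕ} (h1 : N 1 = 0)
    (hle : ∀ g, ∀ s ∈ S, N (g * s) ≤ N g + 1)
    (hdesc : ∀ g, g ≠ 1 → ∃ s ∈ S, s * s = 1 ∧ N (g * s) < N g) (g : Γ) :
    wordLength S g = N g := by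
  have upper : ∀ k : ℕ, ∀ g : Γ, N g = k →
      ∃ l : List Γ, l.length ≤ k ∧ (∀ s ∈ l, s ∈ S) ∧ l.prod = g := by
    intro k
    induction k using Nat.strong_induction_on with
    | _ k ih =>
      intro g hg
      by_cases hg1 : g = 1
      · exact ⟨[], by simp, by simp, by simp [hg1]⟩
      · obtain ⟨s, hs, hss, hlt⟩ := hdesc g hg1
        obtain ⟨l, hl, hlS, hlp⟩ := ih _ (hg ▸ hlt) _ rfl
        refine ⟨l ++ [s], ?_, ?_, ?_⟩
        · simp only [List.length_append, List.length_singleton]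
          omega
        · intro x hx
          rcases List.mem_append.1 hx with hx | hx
          · exact hlS x hx
          · rwa [List.mem_singleton.1 hx]
        · simp [hlp, mul_assoc, hss]
  have lower : ∀ l : List Γ, (∀ s ∈ l, s ∈ S) → N l.prod ≤ l.length := by
    intro l
    induction l using List.reverseRecOn with
    | nil => simp [h1]
    | append_singleton l s ih =>
      intro hl
      have h2 := ih fun x hx => hl x (by simp [hx])
      have h3 := hle l.prod s (hl s (by simp))
      simp only [List.prod_append, List.prod_singleton, List.length_append, List.length_singleton]
      omega
  obtain ⟨l, hl, hlS, hlp⟩ := upper _ g rfl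
  have hmem : l.length ∈ {k | ∃ l : List Γ, l.length = k ∧ (∀ s ∈ l, s ∈ S) ∧ l.prod = g} :=
    ⟨l, rfl, hlS, hlp⟩
  apply le_antisymm ((Nat.sInf_le hmem).trans hl)
  obtain ⟨l', hl', hlS', hlp'⟩ := Nat.sInf_mem ⟨_, hmem⟩
  have := lower l' hlS'
  rw [hlp', hl'] at this
  exact this

/-! ### Inversions of permutations -/

/-- The inversions of a permutation. -/
def inversions {n : ℕ} (ρ : Equiv.Perm (Fin n)) : Finset (Fin n × Fin n) :=
  Finset.univ.filter fun p => p.1 < p.2 ∧ ρ p.2 < ρ p.1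

theorem mem_inversions {n : ℕ} {ρ : Equiv.Perm (Fin n)} {p : Fin n × Fin n} :
    p ∈ inversions ρ ↔ p.1 < p.2 ∧ ρ p.2 < ρ p.1 := by
  simp [inversions]

/-- The old inversions inject into the new ones other than `(i, j)`: a pair is moved by the
transposition if that preserves its order, and is kept otherwise. The pair `(i, j)` itself is a new
inversion. -/
theorem card_inversions_lt_mul_swap {n : ℕ} (ρ : Equiv.Perm (Fin n)) {i j : Fin n} (hij : i < j)
    (hρ : ρ i < ρ j) : (inversions ρ).card < (inversions (ρ * Equiv.swap i j)).card := by
  set s := Equiv.swap i j with hs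
  have hss : ∀ a, s (s a) = a := fun a => Equiv.swap_apply_self i j a
  have hsi : s i = j := Equiv.swap_apply_left i j
  have hsj : s j = i := Equiv.swap_apply_right i j
  have hsc : ∀ c, c ≠ i → c ≠ j → s c = c := fun c h1 h2 => Equiv.swap_apply_of_ne_of_ne h1 h2
  let f : Fin n × Fin n → Fin n × Fin n := fun p => if s p.1 < s p.2 then (s p.1, s p.2) else p
  have hmaps : ∀ p ∈ inversions ρ, f p ∈ (inversions (ρ * s)).erase (i, j) := by
    rintro ⟨a, b⟩ hp
    rw [mem_inversions] at hp
    obtain ⟨hab, hρab⟩ := hp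
    simp only at hab hρab
    rw [Finset.mem_erase, mem_inversions]
    by_cases h : s a < s b
    · simp only [f, h, if_true, Equiv.Perm.mul_apply, hss, hρab, and_true]
      intro he
      rw [Prod.mk.injEq] at he
      have ha : a = j := by rw [← hss a, he.1, hsi]
      have hb : b = i := by rw [← hss b, he.2, hsj]
      subst ha hb
      exact lt_asymm hij hab
    · simp only [f, h, if_false, Equiv.Perm.mul_apply, hab, true_and]
      have hne : ¬ (a = i ∧ b = j) := by
        rintro ⟨rfl, rfl⟩
        exact lt_asymm hρ hρab
      refine ⟨fun he => hne (Prod.mk.inj he), ?_⟩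
      by_cases hai : a = i
      · have hbi : b ≠ i := fun e => by rw [hai, e] at hab; exact lt_irrefl _ hab
        have hbj : b ≠ j := fun e => hne ⟨hai, e⟩
        rw [hai, hsi, hsc b hbi hbj]
        rw [hai] at hρab
        exact hρab.trans hρ
      · by_cases hbj : b = j
        · have haj : a ≠ j := fun e => by rw [hbj, e] at hab; exact lt_irrefl _ hab
          rw [hbj, hsj, hsc a hai haj]
          rw [hbj] at hρab
          exact hρ.trans hρab
        · exfalso
          by_cases haj : a = j
          · have hbi : b ≠ i := fun e => by rw [haj, e] at hab; exact lt_asymm hij hab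
            rw [haj, hsj, hsc b hbi hbj] at h
            rw [haj] at hab
            exact h (hij.trans hab)
          · by_cases hbi : b = i
            · rw [hbi, hsi, hsc a hai haj] at h
              rw [hbi] at hab
              exact h (hab.trans hij)
            · rw [hsc a hai haj, hsc b hbi hbj] at h
              exact h hab
  have hinj : Set.InjOn f (inversions ρ) := by
    rintro ⟨a, b⟩ hp ⟨c, d⟩ hq he
    rw [Finset.mem_coe, mem_inversions] at hp hq
    simp only at hp hq
    by_cases h : s a < s b <;> by_cases h' : s c < s d
    · simp only [f, h, h', if_true, Prod.mk.injEq, EmbeddingLike.apply_eq_iff_eq] at he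
      rw [he.1, he.2]
    · simp only [f, h, h', if_true, if_false, Prod.mk.injEq] at he
      rw [← he.1, ← he.2, hss, hss] at h'
      exact absurd hp.1 h'
    · simp only [f, h, h', if_true, if_false, Prod.mk.injEq] at he
      rw [he.1, he.2, hss, hss] at h
      exact absurd hq.1 h
    · simpa only [f, h, h', if_false] using he
  have hmem : (i, j) ∈ inversions (ρ * s) := by
    rw [mem_inversions]
    simp only [Equiv.Perm.mul_apply, hsi, hsj]
    exact ⟨hij, hρ⟩
  have := Finset.card_le_card_of_injOn f hmaps hinj
  have h2 := Finset.card_erase_lt_of_mem hmem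
  omega

/-- An adjacent transposition reverses the order of no pair except `(i, j)`, so it carries every
other inversion to an inversion. -/
theorem card_inversions_mul_swap_le {n : ℕ} (ρ : Equiv.Perm (Fin n)) {i j : Fin n}
    (hij : (i : ℕ) + 1 = j) :
    (inversions (ρ * Equiv.swap i j)).card ≤ (inversions ρ).card + 1 := by
  set s := Equiv.swap i j with hs
  have hss : ∀ a, s (s a) = a := fun a => Equiv.swap_apply_self i j a
  have hmaps : ∀ p ∈ (inversions (ρ * s)).erase (i, j), (s p.1, s p.2) ∈ inversions ρ := by
    rintro ⟨a, b⟩ hp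
    rw [Finset.mem_erase, mem_inversions] at hp
    obtain ⟨hne, hab, hρ⟩ := hp
    rw [mem_inversions]
    refine ⟨?_, hρ⟩
    have hne' : ¬ ((a : ℕ) = i ∧ (b : ℕ) = j) := fun h => hne
      (Prod.ext (Fin.ext h.1) (Fin.ext h.2))
    simp only [hs, Equiv.swap_apply_def]
    simp only at hab
    split_ifs <;> simp only [Fin.lt_def, Fin.ext_iff] at * <;> omega
  have hinj : Set.InjOn (fun p : Fin n × Fin n => (s p.1, s p.2))
      ((inversions (ρ * s)).erase (i, j)) := by
    rintro ⟨a, b⟩ - ⟨c, d⟩ - he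
    simpa using he
  have h1 := Finset.card_le_card_of_injOn _ hmaps hinj
  have h2 := Finset.pred_card_le_card_erase (s := inversions (ρ * s)) (a := (i, j))
  omega

theorem perm_eq_one_of_lt {n : ℕ} {ρ : Equiv.Perm (Fin n)}
    (h : ∀ i j : Fin n, (i : ℕ) + 1 = j → ρ i < ρ j) : ρ = 1 := by
  have hmono : StrictMono ρ := by
    cases n with
    | zero => exact fun i => i.elim0
    | succ n => exact Fin.strictMono_iff_lt_succ.2 fun i => h _ _ (by simp)
  exact Equiv.ext fun i => hmono.apply_eq

theorem wordLength_finiteSimple {n : ℕ} (ρ : Equiv.Perm (Fin n)) :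
    wordLength (finiteSimple n) ρ = (inversions ρ).card := by
  refine wordLength_eq (N := fun ρ => (inversions ρ).card) ?_ ?_ ?_ ρ
  · rw [Finset.card_eq_zero, Finset.eq_empty_iff_forall_notMem]
    intro p hp
    rw [mem_inversions] at hp
    exact lt_asymm hp.1 hp.2
  · rintro g s ⟨i, j, hij, rfl⟩
    exact card_inversions_mul_swap_le g hij
  · intro g hg
    by_contra hcon
    refine hg (perm_eq_one_of_lt fun i j hij => ?_)
    have hlt : i < j := by rw [Fin.lt_def]; omega
    by_contra hge
    have hgt : g j < g i := lt_of_le_of_ne (not_lt.1 hge)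
      fun e => hlt.ne' (g.injective e)
    refine hcon ⟨Equiv.swap i j, ⟨i, j, hij, rfl⟩, Equiv.swap_mul_self i j, ?_⟩
    have := card_inversions_lt_mul_swap (g * Equiv.swap i j) hlt (by simpa using hgt)
    rwa [mul_assoc, Equiv.swap_mul_self, mul_one] at this

theorem wordLength_lt_mul_swap_iff {n : ℕ} (ρ : Equiv.Perm (Fin n)) {i j : Fin n} (hij : i < j) :
    wordLength (finiteSimple n) ρ < wordLength (finiteSimple n) (ρ * Equiv.swap i j) ↔
      ρ i < ρ j := by
  rw [wordLength_finiteSimple, wordLength_finiteSimple]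
  refine ⟨fun h => ?_, card_inversions_lt_mul_swap ρ hij⟩
  by_contra hge
  have hgt : ρ j < ρ i := lt_of_le_of_ne (not_lt.1 hge) fun e => hij.ne' (ρ.injective e)
  have := card_inversions_lt_mul_swap (ρ * Equiv.swap i j) hij (by simpa using hgt)
  rw [mul_assoc, Equiv.swap_mul_self, mul_one] at this
  exact lt_asymm h this

/-! ### Quasi-additive functions on pairs -/

/-- The conditions satisfied by the integers `⌊v_i - v_j⌋` for `i < j`, where `v` is dominant. -/
structure IsShiTable {n : ℕ} (K : Fin n → Fin n → ℤ) : Prop where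
  nonneg : ∀ a b, a < b → 0 ≤ K a b
  add_le : ∀ a b c, a < b → b < c → K a b + K b c ≤ K a c
  le_add : ∀ a b c, a < b → b < c → K a c ≤ K a b + K b c + 1

/-- The entry at `(a, b)` is as large as the entries at two pairs composing to `(a, b)` permit. -/
def IsBoundedInside {n : ℕ} (K : Fin n → Fin n → ℤ) (a b : Fin n) : Prop :=
  ∃ c, a < c ∧ c < b ∧ K a b = K a c + K c b + 1

/-- The entry at `(a, b)` is as large as some entries at pairs `(b, c)`, `(a, c)` permit. -/
def IsBoundedRight {n : ℕ} (K : Fin n → Fin n → ℤ) (a b : Fin n) : Prop :=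
  ∃ c, b < c ∧ K a c = K a b + K b c

/-- The entry at `(a, b)` is as large as some entries at pairs `(c, a)`, `(c, b)` permit. -/
def IsBoundedLeft {n : ℕ} (K : Fin n → Fin n → ℤ) (a b : Fin n) : Prop :=
  ∃ c, c < a ∧ K c b = K c a + K a b

section
variable {n : ℕ} {K : Fin n → Fin n → ℤ}

/-- Take the least witness `c`. If its entry were at least `m`, it would split at some `p` strictly
between `a` and `c`: `p < b` would split `(a, b)`, `p = b` contradicts the choice of `c`, and `p >
b` would be a smaller witness. -/
theorem IsShiTable.exists_right (hK : IsShiTable K) {m : ℤ} {a b : Fin n} (hab : a < b)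
    (hin : ¬ IsBoundedInside K a b) (hr : IsBoundedRight K a b)
    (h : ∀ c, b < c → m ≤ K a c → IsBoundedInside K a c) :
    ∃ c, b < c ∧ K a c = K a b + K b c ∧ K a c < m := by
  classical
  obtain ⟨c, ⟨hbc, hc⟩, hmin⟩ :=
    WellFounded.has_min (wellFounded_lt (α := Fin n)) {c | b < c ∧ K a c = K a b + K b c} hr
  refine ⟨c, hbc, hc, ?_⟩
  by_contra hm
  obtain ⟨p, hap, hpc, hp⟩ := h c hbc (not_lt.1 hm)
  rcases lt_trichotomy p b with hpb | rfl | hbp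
  · refine hin ⟨p, hap, hpb, ?_⟩
    have h1 := hK.add_le p b c hpb hbc
    have h2 := hK.le_add a p b hap hpb
    omega
  · omega
  · refine hmin p ⟨hbp, ?_⟩ hpc
    have h1 := hK.add_le a b p hab hbp
    have h2 := hK.le_add b p c hbp hpc
    omega

theorem IsShiTable.exists_left (hK : IsShiTable K) {m : ℤ} {a b : Fin n} (hab : a < b)
    (hin : ¬ IsBoundedInside K a b) (hr : IsBoundedLeft K a b)
    (h : ∀ c, c < a → m ≤ K c b → IsBoundedInside K c b) :
    ∃ c, c < a ∧ K c b = K c a + K a b ∧ K c b < m := by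
  classical
  obtain ⟨c, ⟨hca, hc⟩, hmin⟩ :=
    WellFounded.has_min (wellFounded_gt (α := Fin n)) {c | c < a ∧ K c b = K c a + K a b} hr
  refine ⟨c, hca, hc, ?_⟩
  by_contra hm
  obtain ⟨p, hcp, hpb, hp⟩ := h c hca (not_lt.1 hm)
  rcases lt_trichotomy p a with hpa | rfl | hap
  · refine hmin p ⟨hpa, ?_⟩ hcp
    have h1 := hK.add_le p a b hpa hab
    have h2 := hK.le_add c p a hcp hpa
    omega
  · omega
  · refine hin ⟨p, hap, hpb, ?_⟩
    have h1 := hK.add_le c a p hca hap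
    have h2 := hK.le_add a p b hap hpb
    omega

/-- A large unsplit entry cannot be at a ceiling, so it would be tied to a wider pair with entry
below `m`. The difference of those two entries is nonnegative, which is absurd. -/
theorem IsShiTable.isBoundedInside (hK : IsShiTable K) {m : ℤ} {C : Fin n → Fin n → Prop}
    (hC : ∀ a b, a < b →
      C a b ∨ IsBoundedInside K a b ∨ IsBoundedRight K a b ∨ IsBoundedLeft K a b)
    (hm : ∀ a b, a < b → C a b → K a b < m) :
    ∀ a b, a < b → m ≤ K a b → IsBoundedInside K a b := by
  -- The measure `n + a - b` decreases as the pair widens, so wider pairs are treated first.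
  suffices H : ∀ d : ℕ, ∀ a b : Fin n, n + (a : ℕ) - b = d → a < b → m ≤ K a b →
      IsBoundedInside K a b from fun a b => H _ a b rfl
  intro d
  induction d using Nat.strong_induction_on with
  | _ d ih =>
    intro a b hd hab hk
    by_contra hin
    have ha := a.isLt
    have hb := b.isLt
    rcases hC a b hab with h | h | h | h
    · exact absurd (hm a b hab h) (not_lt.2 hk)
    · exact hin h
    · obtain ⟨c, hbc, hc, hcm⟩ := hK.exists_right (m := m) hab hin h fun c hbc hc => by
        have hcl := c.isLt
        rw [Fin.lt_def] at hbc hab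
        exact ih (n + (a : ℕ) - c) (by omega) a c rfl (by rw [Fin.lt_def]; omega) hc
      have := hK.nonneg b c hbc
      omega
    · obtain ⟨c, hca, hc, hcm⟩ := hK.exists_left (m := m) hab hin h fun c hca hc => by
        rw [Fin.lt_def] at hca hab
        exact ih (n + (c : ℕ) - b) (by omega) c b rfl (by rw [Fin.lt_def]; omega) hc
      have := hK.nonneg c a hca
      omega

/-- Here `C` marks the ceilings and `L` is the table of a competing point; comparisons known for
small entries and at ceilings of height `m` propagate to all pairs. A split entry is controlled by
two strictly smaller entries of `K`. An unsplit one is below `m`, hence equal to `m - 1` in the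
remaining case, and is controlled by a wider pair. The induction is accordingly on the entry first
and on the width second. -/
theorem IsShiTable.le_of_le_at_ceilings (hK : IsShiTable K) {L : Fin n → Fin n → ℤ}
    (hL : IsShiTable L) {m : ℤ} {C : Fin n → Fin n → Prop}
    (hC : ∀ a b, a < b →
      C a b ∨ IsBoundedInside K a b ∨ IsBoundedRight K a b ∨ IsBoundedLeft K a b)
    (hm : ∀ a b, a < b → C a b → K a b < m)
    (hlt : ∀ a b, a < b → K a b < m - 1 → L a b ≤ K a b)
    (heq : ∀ a b, a < b → C a b → K a b = m - 1 → L a b ≤ K a b) :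
    ∀ a b, a < b → L a b ≤ K a b := by
  have hins := hK.isBoundedInside hC hm
  suffices H : ∀ k : ℕ, ∀ d : ℕ, ∀ a b : Fin n, (K a b).toNat = k → n + (a : ℕ) - b = d → a < b →
      L a b ≤ K a b from fun a b => H _ _ a b rfl rfl
  intro k
  induction k using Nat.strong_induction_on with
  | _ k ihk =>
  intro d
  induction d using Nat.strong_induction_on with
  | _ d ihd =>
    intro a b hk hd hab
    have hK0 := hK.nonneg a b hab
    rcases lt_or_ge (K a b) (m - 1) with h | h
    · exact hlt a b hab h
    by_cases hin : IsBoundedInside K a b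
    · obtain ⟨c, hac, hcb, hc⟩ := hin
      have h1 := hK.nonneg a c hac
      have h2 := hK.nonneg c b hcb
      have h3 := ihk _ (by omega) _ a c rfl rfl hac
      have h4 := ihk _ (by omega) _ c b rfl rfl hcb
      have h5 := hL.le_add a c b hac hcb
      omega
    have hkm : K a b < m := not_le.1 fun hle => hin (hins a b hab hle)
    have ha := a.isLt
    have hb := b.isLt
    rcases hC a b hab with h' | h' | h' | h'
    · exact heq a b hab h' (by omega)
    · exact absurd h' hin
    -- From `K a c < m` and `K a b ≥ m - 1` it follows that `K b c = 0` and `K a c = K a b`. The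
    -- outer measure is thus unchanged, and the inner induction applies to the wider pair `(a, c)`.
    -- The left-hand case is symmetric.
    · obtain ⟨c, hbc, hc, hcm⟩ := hK.exists_right (m := m) hab hin h'
        fun c hbc hc => hins a c (hab.trans hbc) hc
      have h1 := hK.nonneg b c hbc
      have h2 := hL.nonneg b c hbc
      have h3 := hL.add_le a b c hab hbc
      have h4 : L a c ≤ K a c := by
        have hcl := c.isLt
        rw [Fin.lt_def] at hbc hab
        exact ihd (n + (a : ℕ) - c) (by omega) a c (by omega) rfl (by rw [Fin.lt_def]; omega)
      omega
    · obtain ⟨c, hca, hc, hcm⟩ := hK.exists_left (m := m) hab hin h'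
        fun c hca hc => hins c b (hca.trans hab) hc
      have h1 := hK.nonneg c a hca
      have h2 := hL.nonneg c a hca
      have h3 := hL.add_le c a b hca hab
      have h4 : L c b ≤ K c b := by
        rw [Fin.lt_def] at hca hab
        exact ihd (n + (c : ℕ) - b) (by omega) c b (by omega) rfl (by rw [Fin.lt_def]; omega)
      omega

end

/-! ### Lengths in the affine symmetric group -/

theorem ediv_eq_of_le_of_lt {a d q : ℤ} (h1 : q * d ≤ a) (h2 : a < q * d + d) : a / d = q := by
  have hd : 0 < d := by linarith
  apply le_antisymm
  · rw [← Int.lt_add_one_iff, Int.ediv_lt_iff_lt_mul hd]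
    linarith
  · rwa [Int.le_ediv_iff_mul_le hd]

theorem add_one_ediv {a d : ℤ} (hd : 0 < d) (h : ¬ d ∣ a + 1) : (a + 1) / d = a / d := by
  have h1 := Int.emod_add_mul_ediv a d
  have h2 := Int.emod_nonneg a hd.ne'
  have h3 := Int.emod_lt_of_pos a hd
  have h4 : a % d + 1 ≠ d := fun e => h ⟨a / d + 1, by linear_combination -h1 + e⟩
  have h5 : a % d + 1 < d := lt_of_le_of_ne h3 h4
  apply ediv_eq_of_le_of_lt <;> linarith

theorem sub_one_ediv {a d : ℤ} (hd : 0 < d) (h : ¬ d ∣ a) : (a - 1) / d = a / d := by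
  have := add_one_ediv (a := a - 1) hd (by simpa using h)
  rw [sub_add_cancel] at this
  exact this.symm

/-! ### Generators as periodic transpositions of the integers, and their effect on the table -/

variable {n : ℕ}

/-- The permutation of `ℤ` underlying a generator of the affine symmetric group. -/
def simpleFun (n : ℕ) (i x : ℤ) : ℤ :=
  if x ≡ i - 1 [ZMOD n] then x + 1 else if x ≡ i [ZMOD n] then x - 1 else x

theorem not_modEq_of_modEq_sub_one (hn : 1 < n) {i x : ℤ} (h : x ≡ i - 1 [ZMOD n]) :
    ¬ x ≡ i [ZMOD n] := by
  intro h'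
  have h2 := (h.symm.trans h').dvd
  have h3 := Int.le_of_dvd one_pos (by simpa using h2)
  omega

theorem simpleFun_simpleFun (hn : 1 < n) (i x : ℤ) : simpleFun n i (simpleFun n i x) = x := by
  by_cases h1 : x ≡ i - 1 [ZMOD n]
  · have h2 : x + 1 ≡ i [ZMOD n] := by simpa using h1.add_right 1
    have h3 : ¬ x + 1 ≡ i - 1 [ZMOD n] := fun h => not_modEq_of_modEq_sub_one hn h h2
    simp [simpleFun, h1, h2, h3]
  · by_cases h2 : x ≡ i [ZMOD n]
    · have h3 : x - 1 ≡ i - 1 [ZMOD n] := h2.sub_right 1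
      simp [simpleFun, h1, h2, h3]
    · simp [simpleFun, h1, h2]

theorem simpleFun_left (i c : ℤ) : simpleFun n i (i - 1 + c * n) = i + c * n := by
  have : i - 1 + c * n ≡ i - 1 [ZMOD n] := by simp [Int.ModEq]
  rw [simpleFun, if_pos this]
  ring

theorem simpleFun_right (hn : 1 < n) (i c : ℤ) :
    simpleFun n i (i + c * n) = i - 1 + c * n := by
  rw [← simpleFun_left, simpleFun_simpleFun hn]

theorem simpleFun_of_ne {i x : ℤ} (h1 : ¬ (n : ℤ) ∣ x - (i - 1)) (h2 : ¬ (n : ℤ) ∣ x - i) :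
    simpleFun n i x = x := by
  have h3 : ¬ x ≡ i - 1 [ZMOD n] := fun h => h1 h.symm.dvd
  have h4 : ¬ x ≡ i [ZMOD n] := fun h => h2 h.symm.dvd
  rw [simpleFun, if_neg h3, if_neg h4]

variable [NeZero n]

/-- The integers `⌊v_i - v_j⌋`, where `v` lies in the interior of `w A_0`. -/
def shiTable (w : affineSymm n) (i j : Fin n) : ℤ :=
  ((w : Equiv.Perm ℤ)⁻¹ (j : ℕ) - (w : Equiv.Perm ℤ)⁻¹ (i : ℕ)) / n

theorem inv_shift (w : affineSymm n) : IsShiftEquivariant n (w : Equiv.Perm ℤ)⁻¹ := (w⁻¹).2.1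

theorem not_dvd_inv_sub (w : affineSymm n) {i j : Fin n} (hij : i ≠ j) :
    ¬ (n : ℤ) ∣ (w : Equiv.Perm ℤ)⁻¹ (j : ℕ) - (w : Equiv.Perm ℤ)⁻¹ (i : ℕ) := by
  rintro ⟨k, hk⟩
  refine hij ((res_bijective (inv_shift w)).1 ?_)
  exact ((res_eq_iff n _ _).2 ⟨k, by linear_combination hk⟩).symm

theorem shiTable_mul_le (w : affineSymm n) (i j : Fin n) : shiTable w i j * n ≤
    (w : Equiv.Perm ℤ)⁻¹ (j : ℕ) - (w : Equiv.Perm ℤ)⁻¹ (i : ℕ) :=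
  Int.ediv_mul_le _ (by exact_mod_cast NeZero.ne n)

theorem shiTable_mul_lt (w : affineSymm n) {i j : Fin n} (hij : i ≠ j) : shiTable w i j * n <
    (w : Equiv.Perm ℤ)⁻¹ (j : ℕ) - (w : Equiv.Perm ℤ)⁻¹ (i : ℕ) :=
  lt_of_le_of_ne (shiTable_mul_le w i j)
    fun e => not_dvd_inv_sub w hij ⟨shiTable w i j, by rw [← e, mul_comm]⟩

theorem lt_shiTable_mul (w : affineSymm n) (i j : Fin n) :
    (w : Equiv.Perm ℤ)⁻¹ (j : ℕ) - (w : Equiv.Perm ℤ)⁻¹ (i : ℕ) < shiTable w i j * n + n := by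
  have := Int.lt_ediv_add_one_mul_self
    ((w : Equiv.Perm ℤ)⁻¹ (j : ℕ) - (w : Equiv.Perm ℤ)⁻¹ (i : ℕ))
    (show (0 : ℤ) < n by exact_mod_cast Nat.pos_of_neZero n)
  rw [add_one_mul] at this
  exact this

theorem shiTable_swap (w : affineSymm n) {i j : Fin n} (hij : i ≠ j) :
    shiTable w j i = -1 - shiTable w i j := by
  have h1 := shiTable_mul_lt w hij
  have h2 := lt_shiTable_mul w i j
  apply ediv_eq_of_le_of_lt <;> linarith

theorem exists_inv_eq (w : affineSymm n) (x : ℤ) : ∃ a : Fin n, ∃ c : ℤ,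
    (w : Equiv.Perm ℤ)⁻¹ (a : ℕ) = x + c * n ∧ (w : Equiv.Perm ℤ) x = (a : ℕ) - c * n := by
  obtain ⟨c, hc⟩ := (res_eq_iff n ((res n ((w : Equiv.Perm ℤ) x) : ℕ) : ℤ)
    ((w : Equiv.Perm ℤ) x)).1 (res_natCast _ _)
  refine ⟨res n ((w : Equiv.Perm ℤ) x), c, ?_, by rw [hc]; ring⟩
  rw [hc, (inv_shift w).add_mul]
  simp

theorem sum_ite_modEq (y : ℤ) :
    ∑ a : Fin n, (if ((a : ℕ) : ℤ) ≡ y [ZMOD n] then (1 : ℤ) else 0) = 1 := by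
  have h : ∀ a : Fin n, ((a : ℕ) : ℤ) ≡ y [ZMOD n] ↔ a = res n y := by
    intro a
    rw [← res_natCast n a, res_eq_iff, res_natCast, Int.modEq_iff_dvd]
    constructor
    · rintro ⟨k, hk⟩
      exact ⟨-k, by linear_combination -hk⟩
    · rintro ⟨k, hk⟩
      exact ⟨-k, by linear_combination -hk⟩
  simp [h]

/-- The generators of the affine symmetric group. -/
def simple (hn : 1 < n) (i : ℤ) : affineSymm n :=
  ⟨⟨simpleFun n i, simpleFun n i, simpleFun_simpleFun hn i, simpleFun_simpleFun hn i⟩, by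
    refine ⟨fun x => ?_, ?_⟩
    · have h : ∀ y : ℤ, x + n ≡ y [ZMOD n] ↔ x ≡ y [ZMOD n] := fun y => by
        simp [Int.ModEq]
      simp only [Equiv.coe_fn_mk, simpleFun, h]
      split_ifs <;> ring
    · have h : ∀ x : ℤ, simpleFun n i x = x + (if x ≡ i - 1 [ZMOD n] then 1 else 0) -
          (if x ≡ i [ZMOD n] then 1 else 0) := by
        intro x
        have := not_modEq_of_modEq_sub_one (i := i) (x := x) hn
        unfold simpleFun
        split_ifs <;> first | (exfalso; tauto) | ring
      simp only [Equiv.coe_fn_mk, h, Finset.sum_sub_distrib, Finset.sum_add_distrib,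
        sum_ite_modEq]
      ring⟩

theorem simple_mem (hn : 1 < n) (i : ℤ) : simple hn i ∈ affineSimple n := ⟨i, fun _ => rfl⟩

theorem simple_mul_self (hn : 1 < n) (i : ℤ) : simple hn i * simple hn i = 1 :=
  Subtype.ext (Equiv.ext (simpleFun_simpleFun hn i))

theorem eq_simple (hn : 1 < n) {s : affineSymm n} (hs : s ∈ affineSimple n) :
    ∃ i, s = simple hn i := by
  obtain ⟨i, hi⟩ := hs
  exact ⟨i, Subtype.ext (Equiv.ext hi)⟩

theorem mul_simple_inv_apply (hn : 1 < n) (w : affineSymm n) (i x : ℤ) :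
    ((w * simple hn i : affineSymm n) : Equiv.Perm ℤ)⁻¹ x =
      simpleFun n i ((w : Equiv.Perm ℤ)⁻¹ x) := by
  have h : (w * simple hn i)⁻¹ = simple hn i * w⁻¹ := by
    rw [mul_inv_rev, inv_eq_of_mul_eq_one_left (simple_mul_self hn i)]
  exact congrArg (fun g : affineSymm n => (g : Equiv.Perm ℤ) x) h

/-- Multiplication by a generator on the right changes the table only at one pair. -/
theorem shiTable_mul_simple (hn : 1 < n) (w : affineSymm n) {i c d : ℤ} {a b : Fin n}
    (ha : (w : Equiv.Perm ℤ)⁻¹ (a : ℕ) = i - 1 + c * n)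
    (hb : (w : Equiv.Perm ℤ)⁻¹ (b : ℕ) = i + d * n) :
    shiTable (w * simple hn i) a b = shiTable w a b - 1 ∧
    shiTable (w * simple hn i) b a = shiTable w b a + 1 ∧
    ∀ p q : Fin n, ¬ (p = a ∧ q = b) → ¬ (p = b ∧ q = a) →
      shiTable (w * simple hn i) p q = shiTable w p q := by
  have hn0 : (0 : ℤ) < n := by exact_mod_cast Nat.pos_of_neZero n
  have hn1 : (1 : ℤ) < n := by exact_mod_cast hn
  have hab : a ≠ b := by
    rintro rfl
    have h : (n : ℤ) ∣ 1 := ⟨c - d, by linear_combination ha - hb⟩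
    have := Int.le_of_dvd one_pos h
    omega
  have ha' : ((w * simple hn i : affineSymm n) : Equiv.Perm ℤ)⁻¹ (a : ℕ) = i + c * n := by
    rw [mul_simple_inv_apply, ha, simpleFun_left]
  have hb' : ((w * simple hn i : affineSymm n) : Equiv.Perm ℤ)⁻¹ (b : ℕ) = i - 1 + d * n := by
    rw [mul_simple_inv_apply, hb, simpleFun_right hn]
  have hda : ∀ p : Fin n, p ≠ a → ¬ (n : ℤ) ∣ (w : Equiv.Perm ℤ)⁻¹ (p : ℕ) - (i - 1) := by
    rintro p hp ⟨k, hk⟩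
    exact not_dvd_inv_sub w hp ⟨c - k, by linear_combination ha - hk⟩
  have hdb : ∀ p : Fin n, p ≠ b → ¬ (n : ℤ) ∣ (w : Equiv.Perm ℤ)⁻¹ (p : ℕ) - i := by
    rintro p hp ⟨k, hk⟩
    exact not_dvd_inv_sub w hp ⟨d - k, by linear_combination hb - hk⟩
  have hp' : ∀ p : Fin n, p ≠ a → p ≠ b →
      ((w * simple hn i : affineSymm n) : Equiv.Perm ℤ)⁻¹ (p : ℕ) =
        (w : Equiv.Perm ℤ)⁻¹ (p : ℕ) := by
    intro p hpa hpb
    rw [mul_simple_inv_apply, simpleFun_of_ne (hda p hpa) (hdb p hpb)]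
  -- The two values of `w⁻¹` differ by `(d - c) n + 1` before the multiplication and by `(d - c) n -
  -- 1` after it, so a multiple of `n` is crossed.
  have key : shiTable (w * simple hn i) a b = shiTable w a b - 1 := by
    have h1 : shiTable w a b = d - c := by
      apply ediv_eq_of_le_of_lt <;> rw [ha, hb] <;> linarith
    rw [h1]
    apply ediv_eq_of_le_of_lt <;> rw [ha', hb'] <;> linarith
  refine ⟨key, ?_, ?_⟩
  · rw [shiTable_swap _ hab, shiTable_swap _ hab, key]
    ring
  · intro p q h1 h2
    by_cases hpq : p = q
    · simp [shiTable, hpq]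
    unfold shiTable
    by_cases hpa : p = a
    · have hqa : q ≠ a := fun e => hpq (hpa.trans e.symm)
      have hqb : q ≠ b := fun e => h1 ⟨hpa, e⟩
      rw [hpa, ha', hp' q hqa hqb, ha,
        ← sub_one_ediv (a := (w : Equiv.Perm ℤ)⁻¹ (q : ℕ) - (i - 1 + c * n)) hn0]
      · congr 1; ring
      · rintro ⟨k, hk⟩
        exact hda q hqa ⟨k + c, by linear_combination hk⟩
    by_cases hpb : p = b
    · have hqb : q ≠ b := fun e => hpq (hpb.trans e.symm)
      have hqa : q ≠ a := fun e => h2 ⟨hpb, e⟩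
      rw [hpb, hb', hp' q hqa hqb, hb,
        ← add_one_ediv (a := (w : Equiv.Perm ℤ)⁻¹ (q : ℕ) - (i + d * n)) hn0]
      · congr 1; ring
      · rintro ⟨k, hk⟩
        exact hda q hqa ⟨k + d, by linear_combination hk⟩
    rw [hp' p hpa hpb]
    by_cases hqa : q = a
    · rw [hqa, ha', ha,
        ← add_one_ediv (a := i - 1 + c * n - (w : Equiv.Perm ℤ)⁻¹ (p : ℕ)) hn0]
      · congr 1; ring
      · rintro ⟨k, hk⟩
        exact hdb p hpb ⟨c - k, by linear_combination -hk⟩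
    by_cases hqb : q = b
    · rw [hqb, hb', hb,
        ← sub_one_ediv (a := i + d * n - (w : Equiv.Perm ℤ)⁻¹ (p : ℕ)) hn0]
      · congr 1; ring
      · rintro ⟨k, hk⟩
        exact hdb p hpb ⟨d - k, by linear_combination -hk⟩
    rw [hp' q hqa hqb]

/-- The number of hyperplanes separating `w A_0` from `A_0`. -/
def separation (w : affineSymm n) : ℕ :=
  ∑ p : Fin n × Fin n with p.1 < p.2, (shiTable w p.1 p.2).natAbs

theorem separation_add {w w' : affineSymm n} {a b : Fin n} (hab : a < b)
    (h : ∀ p q : Fin n, p < q → ¬ (p = a ∧ q = b) → shiTable w' p q = shiTable w p q) :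
    separation w' + (shiTable w a b).natAbs = separation w + (shiTable w' a b).natAbs := by
  have hmem : (a, b) ∈ Finset.univ.filter fun p : Fin n × Fin n => p.1 < p.2 := by simpa
  have h1 : ∑ p ∈ (Finset.univ.filter fun p : Fin n × Fin n => p.1 < p.2).erase (a, b),
        (shiTable w' p.1 p.2).natAbs =
      ∑ p ∈ (Finset.univ.filter fun p : Fin n × Fin n => p.1 < p.2).erase (a, b),
        (shiTable w p.1 p.2).natAbs := by
    refine Finset.sum_congr rfl fun p hp => ?_
    rw [Finset.mem_erase, Finset.mem_filter] at hp
    rw [h p.1 p.2 hp.2.2 fun e => hp.1 (Prod.ext e.1 e.2)]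
  unfold separation
  rw [← Finset.add_sum_erase _ _ hmem, ← Finset.add_sum_erase _ _ hmem, h1]
  ring

/-- The positions `a`, `b` carrying the residues `i - 1` and `i` under `w⁻¹` form the only pair
affected. Comparing `w i` with `w (i - 1)` decides on which side of the crossed hyperplane the
alcove lies. -/
theorem separation_mul_simple_le (hn : 1 < n) (w : affineSymm n) (i : ℤ) :
    separation (w * simple hn i) ≤ separation w + 1 ∧
      ((w : Equiv.Perm ℤ) i < (w : Equiv.Perm ℤ) (i - 1) →
        separation (w * simple hn i) < separation w) := by
  have hn0 : (0 : ℤ) < n := by exact_mod_cast Nat.pos_of_neZero n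
  have hn1 : (1 : ℤ) < n := by exact_mod_cast hn
  obtain ⟨a, c, ha, hwa⟩ := exists_inv_eq w (i - 1)
  obtain ⟨b, d, hb, hwb⟩ := exists_inv_eq w i
  obtain ⟨h1, h2, h3⟩ := shiTable_mul_simple hn w ha hb
  rw [hwa, hwb]
  have hab : a ≠ b := by
    rintro rfl
    omega
  have hal : ((a : ℕ) : ℤ) < n := by exact_mod_cast a.isLt
  have hbl : ((b : ℕ) : ℤ) < n := by exact_mod_cast b.isLt
  have hk1 := shiTable_mul_lt w hab
  have hk2 := lt_shiTable_mul w a b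
  have hk : shiTable w a b = d - c := by
    apply ediv_eq_of_le_of_lt <;> rw [ha, hb] <;> linarith
  rcases lt_or_gt_of_ne hab with hlt | hlt
  · have := separation_add (w := w) (w' := w * simple hn i) hlt fun p q hpq hne =>
      h3 p q hne fun e => by rw [e.1, e.2] at hpq; exact lt_asymm hlt hpq
    refine ⟨by omega, fun hw => ?_⟩
    have h4 : 0 < d - c := by
      by_contra hneg
      have : (d - c) * n ≤ 0 := mul_nonpos_of_nonpos_of_nonneg (not_lt.1 hneg) hn0.le
      rw [Fin.lt_def] at hlt
      linarith [(Nat.cast_lt (α := ℤ)).2 hlt]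
    omega
  · have := separation_add (w := w) (w' := w * simple hn i) hlt fun p q hpq hne =>
      h3 p q (fun e => by rw [e.1, e.2] at hpq; exact lt_asymm hlt hpq) hne
    refine ⟨by omega, fun hw => ?_⟩
    have h4 : 0 ≤ d - c := by
      by_contra hneg
      have : (d - c + 1) * n ≤ 0 := mul_nonpos_of_nonpos_of_nonneg (by omega) hn0.le
      have hb0 : (0 : ℤ) ≤ (b : ℕ) := by positivity
      linarith
    have h5 := shiTable_swap w hab
    omega

/-- An increasing bijection of the integers is a translation, and the normalisation of the sum makes
the translation trivial. -/
theorem eq_one_of_forall_le {w : affineSymm n}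
    (h : ∀ i : ℤ, (w : Equiv.Perm ℤ) (i - 1) ≤ (w : Equiv.Perm ℤ) i) : w = 1 := by
  have hmono : StrictMono (w : Equiv.Perm ℤ) := by
    refine strictMono_int_of_lt_succ fun x => lt_of_le_of_ne ?_ fun e => ?_
    · simpa using h (x + 1)
    · have := (w : Equiv.Perm ℤ).injective e
      omega
  have hsucc : ∀ x : ℤ, (w : Equiv.Perm ℤ) (x + 1) = (w : Equiv.Perm ℤ) x + 1 := by
    intro x
    obtain ⟨z, hz⟩ := (w : Equiv.Perm ℤ).surjective ((w : Equiv.Perm ℤ) x + 1)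
    have h1 : x < z := hmono.lt_iff_lt.1 (by omega)
    have h2 : (w : Equiv.Perm ℤ) (x + 1) ≤ (w : Equiv.Perm ℤ) z := hmono.monotone (by omega)
    have h3 : (w : Equiv.Perm ℤ) x < (w : Equiv.Perm ℤ) (x + 1) := hmono (by omega)
    omega
  have hnat : ∀ k : ℕ, (w : Equiv.Perm ℤ) k = (w : Equiv.Perm ℤ) 0 + k := by
    intro k
    induction k with
    | zero => simp
    | succ k ih => push_cast; rw [hsucc, ih]; ring
  have hsum := w.2.2
  simp only [hnat, Finset.sum_add_distrib, Finset.sum_const, Finset.card_univ, Fintype.card_fin,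
    nsmul_eq_mul, add_eq_right, mul_eq_zero, NeZero.ne, false_or] at hsum
  refine Subtype.ext (Equiv.ext fun x => ?_)
  induction x using Int.induction_on with
  | zero => exact hsum
  | succ k ih =>
    rw [hsucc, ih]
    rfl
  | pred k ih =>
    have := hsucc (-k - 1)
    rw [sub_add_cancel, ih] at this
    simp only [OneMemClass.coe_one, Equiv.Perm.coe_one, id_eq] at this ⊢
    omega

theorem wordLength_affineSimple (hn : 1 < n) (w : affineSymm n) :
    wordLength (affineSimple n) w = separation w := by
  refine wordLength_eq (N := separation) ?_ ?_ ?_ w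
  · refine Finset.sum_eq_zero fun p hp => ?_
    rw [Finset.mem_filter] at hp
    have h1 := hp.2
    have h2 := p.2.isLt
    rw [Fin.lt_def] at h1
    have : shiTable (1 : affineSymm n) p.1 p.2 = 0 := by
      apply ediv_eq_of_le_of_lt <;> simp <;> omega
    simp [this]
  · intro g s hs
    obtain ⟨i, rfl⟩ := eq_simple hn hs
    exact (separation_mul_simple_le hn g i).1
  · intro g hg
    by_contra hcon
    refine hg (eq_one_of_forall_le fun i => ?_)
    by_contra hlt
    exact hcon ⟨_, simple_mem hn i, simple_mul_self hn i,
      (separation_mul_simple_le hn g i).2 (not_le.1 hlt)⟩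

/-! ### Geometry of alcoves -/

/-- The root `ε_i - ε_j` as an element of `V`. -/
def rootVec {n : ℕ} (i j : Fin n) : V n :=
  ⟨root i j, by
    change ∑ l, root i j l = 0
    simp [root, Finset.sum_sub_distrib]⟩

theorem rootVec_apply {n : ℕ} (i j l : Fin n) :
    (rootVec i j : EuclideanSpace ℝ (Fin n)) l =
      (if l = i then 1 else 0) - (if l = j then 1 else 0) := by
  simp [rootVec, root]

theorem inner_root {n : ℕ} (v : EuclideanSpace ℝ (Fin n)) (i j : Fin n) :
    inner ℝ v (root i j) = v i - v j := by
  simp [root, inner_sub_right, EuclideanSpace.inner_single_right]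

theorem eventually_add_smul_mem {n : ℕ} {y : V n} {T : Set (V n)} (hT : T ∈ 𝓝 y) (d : V n) :
    ∃ ε : ℝ, 0 < ε ∧ y + ε • d ∈ T ∧ y + (-ε) • d ∈ T := by
  have hc : Filter.Tendsto (fun ε : ℝ => y + ε • d) (𝓝 0) (𝓝 y) := by
    have : Continuous fun ε : ℝ => y + ε • d := by fun_prop
    simpa using this.tendsto 0
  obtain ⟨δ, hδ, h⟩ := Metric.eventually_nhds_iff.1 (hc.eventually hT)
  refine ⟨δ / 2, by positivity, h ?_, h ?_⟩ <;> simp [abs_of_pos hδ] <;> exact hδ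

theorem extend_smul (w : affineSymm n) (y : V n) (x : ℤ) :
    extend (w • y) x = extend y ((w : Equiv.Perm ℤ)⁻¹ x) := extend_act w y x

theorem continuous_extend (z : ℤ) : Continuous fun y : V n => extend y z := by
  unfold extend
  fun_prop

theorem extend_combo {a b : ℝ} (hab : a + b = 1) (x y : V n) (z : ℤ) :
    extend (a • x + b • y) z = a * extend x z + b * extend y z := by
  simp only [extend, Submodule.coe_add, Submodule.coe_smul, PiLp.add_apply, PiLp.smul_apply,
    smul_eq_mul]
  linear_combination ((z / n : ℤ) : ℝ) * hab

theorem exists_eq_add_mul (t : ℤ) : ∃ (r : Fin n) (q : ℤ), t = (r : ℕ) + q * n :=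
  ⟨res n t, t / n, by rw [res_val, mul_comm, Int.emod_add_mul_ediv]⟩

/-- The extended sequence drops by one over each period, so the step from position `n - 1` to `n`
encodes the inequality for the highest root, and the other steps encode the simple roots. -/
theorem mem_fundamentalAlcove_iff (v : V n) :
    v ∈ fundamentalAlcove n ↔ ∀ t : ℤ, extend v (t + 1) ≤ extend v t := by
  have h0 : (((0 : Fin n) : ℕ) : ℤ) = 0 := by simp
  have hlast : (((Fin.rev (0 : Fin n)) : ℕ) : ℤ) = n - 1 := by
    have := Nat.pos_of_neZero n
    rw [Fin.val_rev]
    simp only [Fin.coe_ofNat_eq_mod, Nat.zero_mod]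
    omega
  simp only [fundamentalAlcove, dominantChamber, upperHalf, lowerHalf, Set.mem_inter_iff,
    Set.mem_iInter, Set.mem_ofPred_eq, inner_root, Int.cast_zero, Int.cast_one, sub_nonneg]
  constructor
  · rintro ⟨h1, h2⟩ t
    obtain ⟨r, q, rfl⟩ := exists_eq_add_mul (n := n) t
    rw [extend_add_mul, extend_natCast]
    by_cases hr : (r : ℕ) + 1 < n
    · have e : ((r : ℕ) : ℤ) + q * n + 1 = ((⟨r + 1, hr⟩ : Fin n) : ℕ) + q * n := by
        push_cast
        ring
      rw [e, extend_add_mul, extend_natCast]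
      linarith [h1 r ⟨r + 1, hr⟩ rfl]
    · have hr' : r = Fin.rev 0 := by
        rw [Fin.ext_iff, ← Int.natCast_inj, hlast]
        have := r.isLt
        omega
      have e : ((r : ℕ) : ℤ) + q * n + 1 = (((0 : Fin n) : ℕ) : ℤ) + (q + 1) * n := by
        rw [hr', hlast, h0]
        ring
      rw [e, extend_add_mul, extend_natCast, hr']
      push_cast
      linarith
  · intro h
    refine ⟨fun i j hij => ?_, ?_⟩
    · rw [← extend_natCast v i, ← extend_natCast v j, ← hij]
      push_cast
      exact h _
    · have h1 := h (n - 1)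
      rw [← hlast, extend_natCast, hlast,
        show (n : ℤ) - 1 + 1 = (((0 : Fin n) : ℕ) : ℤ) + 1 * n by rw [h0]; ring,
        extend_add_mul, extend_natCast] at h1
      push_cast at h1
      linarith

theorem mem_alcove_iff (w : affineSymm n) (y : V n) :
    y ∈ alcove w ↔ ∀ t : ℤ,
      extend y ((w : Equiv.Perm ℤ) (t + 1)) ≤ extend y ((w : Equiv.Perm ℤ) t) := by
  have h : ∀ t, extend (w⁻¹ • y) t = extend y ((w : Equiv.Perm ℤ) t) := fun t => by
    rw [extend_smul]
    simp
  simp only [← h, ← mem_fundamentalAlcove_iff]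
  exact Set.mem_smul_set_iff_inv_smul_mem

theorem isClosed_alcove (w : affineSymm n) : IsClosed (alcove w) := by
  have : alcove w = ⋂ t : ℤ, {y | extend y ((w : Equiv.Perm ℤ) (t + 1)) ≤
      extend y ((w : Equiv.Perm ℤ) t)} := by
    ext y
    rw [mem_alcove_iff, Set.mem_iInter]
    rfl
  rw [this]
  exact isClosed_iInter fun t => isClosed_le (continuous_extend _) (continuous_extend _)

theorem extend_apply_add_mul (w : affineSymm n) (y : V n) (t k : ℤ) :
    extend y ((w : Equiv.Perm ℤ) (t + k * n)) = extend y ((w : Equiv.Perm ℤ) t) - k := by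
  have h : IsShiftEquivariant n (w : Equiv.Perm ℤ) := w.2.1
  rw [h.add_mul, extend_add_mul]

theorem extend_apply_inv (w : affineSymm n) (y : V n) (i : Fin n) :
    extend y ((w : Equiv.Perm ℤ) ((w : Equiv.Perm ℤ)⁻¹ (i : ℕ))) =
      (y : EuclideanSpace ℝ (Fin n)) i := by
  simp [extend_natCast]

theorem antitone_of_mem_alcove {w : affineSymm n} {y : V n} (h : y ∈ alcove w) :
    Antitone fun t : ℤ => extend y ((w : Equiv.Perm ℤ) t) :=
  antitone_int_of_succ_le ((mem_alcove_iff w y).1 h)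

theorem sub_mem_Icc_of_mem_alcove {w : affineSymm n} {y : V n} (h : y ∈ alcove w) (i j : Fin n) :
    (y : EuclideanSpace ℝ (Fin n)) i - (y : EuclideanSpace ℝ (Fin n)) j ∈
      Set.Icc (shiTable w i j : ℝ) (shiTable w i j + 1) := by
  have ha := antitone_of_mem_alcove h
  have h1 := shiTable_mul_le w i j
  have h2 := lt_shiTable_mul w i j
  have h3 := ha (show (w : Equiv.Perm ℤ)⁻¹ (i : ℕ) + shiTable w i j * n ≤
    (w : Equiv.Perm ℤ)⁻¹ (j : ℕ) by linarith)
  have h4 := ha (show (w : Equiv.Perm ℤ)⁻¹ (j : ℕ) ≤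
    (w : Equiv.Perm ℤ)⁻¹ (i : ℕ) + (shiTable w i j + 1) * n by linarith)
  simp only [extend_apply_add_mul, extend_apply_inv] at h3 h4
  push_cast at h4
  constructor <;> linarith

theorem sub_mem_Ioo_of_mem_interior {w : affineSymm n} {y : V n} (h : y ∈ interior (alcove w))
    {i j : Fin n} (hij : i ≠ j) :
    (y : EuclideanSpace ℝ (Fin n)) i - (y : EuclideanSpace ℝ (Fin n)) j ∈
      Set.Ioo (shiTable w i j : ℝ) (shiTable w i j + 1) := by
  -- Moving by `±ε` along the root keeps the point in the alcove, which turns the weak bounds into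
  -- strict ones.
  obtain ⟨ε, hε, h1, h2⟩ := eventually_add_smul_mem (mem_interior_iff_mem_nhds.1 h) (rootVec i j)
  have h3 := sub_mem_Icc_of_mem_alcove h1 i j
  have h4 := sub_mem_Icc_of_mem_alcove h2 i j
  simp only [Submodule.coe_add, Submodule.coe_smul, PiLp.add_apply, PiLp.smul_apply,
    rootVec_apply, smul_eq_mul, hij, hij.symm, if_true, if_false, Set.mem_Icc] at h3 h4
  constructor <;> linarith

/-! ### A sample point in the interior of each alcove -/

variable (n) in
/-- The centre of the fundamental alcove. -/
def centre : V n :=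
  ⟨WithLp.toLp 2 fun i : Fin n => ((n : ℝ) - 1) / (2 * n) - ((i : ℕ) : ℝ) / n, by
    change ∑ i : Fin n, (((n : ℝ) - 1) / (2 * n) - ((i : ℕ) : ℝ) / n) = 0
    have hn : (n : ℝ) ≠ 0 := by exact_mod_cast NeZero.ne n
    have h1 : (∑ i : Fin n, ((i : ℕ) : ℝ)) * 2 = n * (n - 1) := by
      rw [Fin.sum_univ_eq_sum_range (fun i : ℕ => (i : ℝ)) n]
      have h2 := Finset.sum_range_id_mul_two n
      have h3 : ((n - 1 : ℕ) : ℝ) = n - 1 := by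
        rw [Nat.cast_sub (Nat.pos_of_neZero n), Nat.cast_one]
      rw [← h3, ← Nat.cast_sum, ← Nat.cast_two, ← Nat.cast_mul, ← Nat.cast_mul, h2]
    rw [Finset.sum_sub_distrib, Finset.sum_const, Finset.card_univ, Fintype.card_fin,
      nsmul_eq_mul, ← Finset.sum_div Finset.univ fun i : Fin n => ((i : ℕ) : ℝ)]
    have h2 : ∑ i : Fin n, ((i : ℕ) : ℝ) = n * (n - 1) / 2 := by linarith
    rw [h2]
    field_simp
    ring⟩

/-- The constants in `centre` make the extended sequence affine in `z`, so every translate `w •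
centre n` can be computed from `w⁻¹` alone. -/
theorem extend_centre (z : ℤ) :
    extend (centre n) z = ((n : ℝ) - 1) / (2 * n) - (z : ℝ) / n := by
  have hn : (n : ℝ) ≠ 0 := by exact_mod_cast NeZero.ne n
  obtain ⟨r, q, rfl⟩ := exists_eq_add_mul (n := n) z
  rw [extend_add_mul, extend_natCast]
  change ((n : ℝ) - 1) / (2 * n) - ((r : ℕ) : ℝ) / n - q = _
  push_cast
  field_simp
  ring

theorem mem_interior_alcove {w : affineSymm n} {y : V n}
    (h : ∀ t : ℤ, extend y ((w : Equiv.Perm ℤ) (t + 1)) < extend y ((w : Equiv.Perm ℤ) t)) :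
    y ∈ interior (alcove w) := by
  refine mem_interior.2 ⟨⋂ t : Fin n, {y | extend y ((w : Equiv.Perm ℤ) ((t : ℕ) + 1)) <
    extend y ((w : Equiv.Perm ℤ) (t : ℕ))}, ?_, ?_, Set.mem_iInter.2 fun t => h _⟩
  · intro z hz
    rw [mem_alcove_iff]
    intro t
    obtain ⟨r, q, rfl⟩ := exists_eq_add_mul (n := n) t
    rw [add_right_comm, extend_apply_add_mul, extend_apply_add_mul]
    have := Set.mem_iInter.1 hz r
    simp only [Set.mem_ofPred_eq] at this
    linarith
  · exact isOpen_iInter_of_finite fun t => isOpen_lt (continuous_extend _) (continuous_extend _)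

theorem smul_centre_mem_interior (w : affineSymm n) : w • centre n ∈ interior (alcove w) := by
  refine mem_interior_alcove fun t => ?_
  have hn : (0 : ℝ) < n := by exact_mod_cast Nat.pos_of_neZero n
  simp only [extend_smul, extend_centre, Equiv.Perm.inv_def, Equiv.symm_apply_apply]
  push_cast
  rw [sub_lt_sub_iff_left]
  exact div_lt_div_of_pos_right (by linarith) hn

theorem smul_centre_sub_mem_Ioo (w : affineSymm n) {i j : Fin n} (hij : i ≠ j) :
    (w • centre n : V n).1 i - (w • centre n : V n).1 j ∈
      Set.Ioo (shiTable w i j : ℝ) (shiTable w i j + 1) :=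
  sub_mem_Ioo_of_mem_interior (smul_centre_mem_interior w) hij

/-! ### Regions of the Shi arrangement -/

/-- The points `v` and `y` lie strictly on the same side of every hyperplane of the `m`-Shi
arrangement. -/
def SameRegion (m : ℕ) (v y : V n) : Prop :=
  ∀ i j : Fin n, i < j → ∀ k : ℤ, -(m : ℤ) < k → k ≤ m →
    ((k : ℝ) < v.1 i - v.1 j ∧ (k : ℝ) < y.1 i - y.1 j) ∨
      (v.1 i - v.1 j < (k : ℝ) ∧ y.1 i - y.1 j < (k : ℝ))

omit [NeZero n] in
theorem mem_compl_shiArrangement {m : ℕ} {v : V n} : v ∈ (⋃₀ shiArrangement n m)ᶜ ↔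
    ∀ i j : Fin n, i < j → ∀ k : ℤ, -(m : ℤ) < k → k ≤ m → v.1 i - v.1 j ≠ (k : ℝ) := by
  rw [Set.mem_compl_iff, Set.mem_sUnion]
  constructor
  · intro h i j hij k h1 h2 he
    exact h ⟨_, ⟨i, j, hij, k, h1, h2, rfl⟩, by simpa [hyperplane, inner_root] using he⟩
  · rintro h ⟨_, ⟨i, j, hij, k, h1, h2, rfl⟩, hv⟩
    exact h i j hij k h1 h2 (by simpa [hyperplane, inner_root] using hv)

omit [NeZero n] in
theorem SameRegion.trans {m : ℕ} {v y z : V n} (h : SameRegion m v y) (h' : SameRegion m y z) :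
    SameRegion m v z := by
  intro i j hij k h1 h2
  rcases h i j hij k h1 h2 with ⟨h3, h4⟩ | ⟨h3, h4⟩ <;>
    rcases h' i j hij k h1 h2 with ⟨h5, h6⟩ | ⟨h5, h6⟩
  · exact Or.inl ⟨h3, h6⟩
  · exact absurd h4 (lt_asymm h5)
  · exact absurd h4 (lt_asymm h5)
  · exact Or.inr ⟨h3, h6⟩

omit [NeZero n] in
-- Points of one component cannot be separated by a hyperplane, by the intermediate value theorem.
-- Conversely, the points with a given sign vector form a convex set that avoids the arrangement.
theorem connectedComponentIn_shiArrangement {m : ℕ} {v : V n}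
    (hv : v ∈ (⋃₀ shiArrangement n m)ᶜ) :
    connectedComponentIn (⋃₀ shiArrangement n m)ᶜ v = {y | SameRegion m v y} := by
  apply Set.Subset.antisymm
  · intro y hy i j hij k h1 h2
    have hsub := connectedComponentIn_subset (⋃₀ shiArrangement n m)ᶜ v
    have hvk := mem_compl_shiArrangement.1 hv i j hij k h1 h2
    have hyk := mem_compl_shiArrangement.1 (hsub hy) i j hij k h1 h2
    have hmem := mem_connectedComponentIn hv
    have hpre := isPreconnected_connectedComponentIn (x := v) (F := (⋃₀ shiArrangement n m)ᶜ)
    have hcont : Continuous fun z : V n => z.1 i - z.1 j := by fun_prop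
    rcases lt_or_gt_of_ne hvk with h3 | h3 <;> rcases lt_or_gt_of_ne hyk with h4 | h4
    · exact Or.inr ⟨h3, h4⟩
    · obtain ⟨z, hz, hzk⟩ := hpre.intermediate_value hmem hy hcont.continuousOn ⟨h3.le, h4.le⟩
      exact absurd hzk (mem_compl_shiArrangement.1 (hsub hz) i j hij k h1 h2)
    · obtain ⟨z, hz, hzk⟩ := hpre.intermediate_value hy hmem hcont.continuousOn ⟨h4.le, h3.le⟩
      exact absurd hzk (mem_compl_shiArrangement.1 (hsub hz) i j hij k h1 h2)
    · exact Or.inl ⟨h3, h4⟩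
  · refine IsPreconnected.subset_connectedComponentIn (Convex.isPreconnected ?_) ?_ ?_
    · intro x hx y hy a b ha hb hab i j hij k h1 h2
      simp only [Submodule.coe_add, Submodule.coe_smul, PiLp.add_apply, PiLp.smul_apply,
        smul_eq_mul]
      have hk : (k : ℝ) = a * k + b * k := by rw [← add_mul, hab, one_mul]
      have key : 0 < a ∨ 0 < b := by
        by_contra! hcon
        linarith [hcon.1, hcon.2]
      rcases hx i j hij k h1 h2 with ⟨h3, h4⟩ | ⟨h3, h4⟩ <;>
        rcases hy i j hij k h1 h2 with ⟨h5, h6⟩ | ⟨h5, h6⟩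
      · refine Or.inl ⟨h3, ?_⟩
        have h7 := mul_le_mul_of_nonneg_left h4.le ha
        have h8 := mul_le_mul_of_nonneg_left h6.le hb
        rcases key with h | h
        · have := mul_lt_mul_of_pos_left h4 h
          linarith
        · have := mul_lt_mul_of_pos_left h6 h
          linarith
      · exact absurd h3 (lt_asymm h5)
      · exact absurd h3 (lt_asymm h5)
      · refine Or.inr ⟨h3, ?_⟩
        have h7 := mul_le_mul_of_nonneg_left h4.le ha
        have h8 := mul_le_mul_of_nonneg_left h6.le hb
        rcases key with h | h
        · have := mul_lt_mul_of_pos_left h4 h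
          linarith
        · have := mul_lt_mul_of_pos_left h6 h
          linarith
    · intro i j hij k h1 h2
      rcases lt_or_gt_of_ne (mem_compl_shiArrangement.1 hv i j hij k h1 h2) with h | h
      · exact Or.inr ⟨h, h⟩
      · exact Or.inl ⟨h, h⟩
    · intro y hy
      rw [mem_compl_shiArrangement]
      intro i j hij k h1 h2
      rcases hy i j hij k h1 h2 with h | h
      · exact h.2.ne'
      · exact h.2.ne

omit [NeZero n] in
theorem sameRegion_of_mem_Ioo {m : ℕ} {x y : V n} {K L : Fin n → Fin n → ℤ}
    (hx : ∀ i j, i < j → x.1 i - x.1 j ∈ Set.Ioo (K i j : ℝ) (K i j + 1))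
    (hy : ∀ i j, i < j → y.1 i - y.1 j ∈ Set.Ioo (L i j : ℝ) (L i j + 1))
    (h : ∀ i j, i < j → ∀ k : ℤ, -(m : ℤ) < k → k ≤ m → (k ≤ K i j ↔ k ≤ L i j)) :
    SameRegion m x y := by
  intro i j hij k h1 h2
  have hx' := hx i j hij
  have hy' := hy i j hij
  by_cases hk : k ≤ K i j
  · have hk' := (h i j hij k h1 h2).1 hk
    exact Or.inl ⟨lt_of_le_of_lt (by exact_mod_cast hk) hx'.1,
      lt_of_le_of_lt (by exact_mod_cast hk') hy'.1⟩
  · have hk' : ¬ k ≤ L i j := fun h' => hk ((h i j hij k h1 h2).2 h')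
    have h3 := Int.add_one_le_iff.2 (not_le.1 hk)
    have h4 := Int.add_one_le_iff.2 (not_le.1 hk')
    exact Or.inr ⟨hx'.2.trans_le (by exact_mod_cast h3), hy'.2.trans_le (by exact_mod_cast h4)⟩

theorem sameRegion_of_mem_interior {m : ℕ} {w : affineSymm n} {y : V n}
    (hy : y ∈ interior (alcove w)) : SameRegion m (w • centre n) y :=
  sameRegion_of_mem_Ioo (fun _ _ hij => smul_centre_sub_mem_Ioo w hij.ne)
    (fun _ _ hij => sub_mem_Ioo_of_mem_interior hy hij.ne) fun _ _ _ _ _ _ => Iff.rfl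

/-- An alcove interior lies wholly in one region, so the centre of the alcove decides which region
that is, and topology drops out of the length condition. -/
theorem isMaximal_iff (hn : 1 < n) {m : ℕ} {w : affineSymm n} :
    IsMaximal m w ↔ Bornology.IsBounded {y : V n | SameRegion m (w • centre n) y} ∧
      ∀ w' : affineSymm n, SameRegion m (w • centre n) (w' • centre n) →
        separation w' ≤ separation w := by
  simp only [IsMaximal, wordLength_affineSimple hn]
  have hin : ∀ (v : V n) (w : affineSymm n), AlcoveIn w {y | SameRegion m v y} ↔
      SameRegion m v (w • centre n) := fun v w =>
    ⟨fun h => h (smul_centre_mem_interior w),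
      fun h y hy => h.trans (sameRegion_of_mem_interior hy)⟩
  constructor
  · rintro ⟨R, ⟨v, hv, rfl⟩, hb, hw, hmax⟩
    rw [connectedComponentIn_shiArrangement hv] at hb hw hmax
    rw [hin] at hw
    exact ⟨hb.subset fun y hy => hw.trans hy, fun w' hw' => hmax w' ((hin _ _).2 (hw.trans hw'))⟩
  · rintro ⟨hb, hmax⟩
    have hself : SameRegion m (w • centre n) (w • centre n) :=
      sameRegion_of_mem_interior (smul_centre_mem_interior w)
    have hc : w • centre n ∈ (⋃₀ shiArrangement n m)ᶜ := by
      rw [mem_compl_shiArrangement]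
      intro i j hij k h1 h2
      rcases hself i j hij k h1 h2 with h | h
      · exact h.2.ne'
      · exact h.2.ne
    refine ⟨_, ⟨_, hc, rfl⟩, ?_⟩
    rw [connectedComponentIn_shiArrangement hc]
    exact ⟨hb, (hin _ _).2 hself, fun w' hw' => hmax w' ((hin _ _).1 hw')⟩

/-! ### Ceilings -/

theorem frontier_alcove_subset (w : affineSymm n) : frontier (alcove w) ⊆ alcove w :=
  (isClosed_alcove w).frontier_subset

omit [NeZero n] in
theorem mem_hyperplane_root {i j : Fin n} {k : ℤ} {y : V n} :
    y ∈ hyperplane (root i j) k ↔ y.1 i - y.1 j = (k : ℝ) := by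
  simp [hyperplane, inner_root]

/-- On the alcove the sequence `t ↦ extend y (w t)` is decreasing, and on the hyperplane its values
at `p` and `q` agree. If some index lay strictly between them, its value would have to agree too,
and this second equation would hold on a relatively open part of the hyperplane. -/
theorem inv_sub_eq_of_isCeiling {m : ℕ} (hm : 1 ≤ m) {w : affineSymm n} {i j : Fin n}
    (hij : i ≠ j) (h : IsCeiling (alcove w) (root i j) m) :
    (w : Equiv.Perm ℤ)⁻¹ (j : ℕ) - (w : Equiv.Perm ℤ)⁻¹ (i : ℕ) = m * n - 1 := by
  have hm' : (1 : ℝ) ≤ m := by exact_mod_cast hm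
  have hn0 : (0 : ℤ) < n := by exact_mod_cast Nat.pos_of_neZero n
  obtain ⟨⟨x, hxH, hfr⟩, -, hside⟩ := h
  have hlow : insert 0 (alcove w) ⊆ lowerHalf (root i j) m := by
    refine hside.resolve_left fun hup => ?_
    have h0 := hup (Set.mem_insert _ _)
    simp only [upperHalf, inner_root, Set.mem_ofPred_eq, ZeroMemClass.coe_zero, PiLp.zero_apply,
      sub_zero, Int.cast_natCast] at h0
    linarith
  set p := (w : Equiv.Perm ℤ)⁻¹ (j : ℕ) - m * n with hp
  set q := (w : Equiv.Perm ℤ)⁻¹ (i : ℕ) with hq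
  have hpq : p < q := by
    have h1 := hlow (Set.mem_insert_of_mem _ (interior_subset (smul_centre_mem_interior w)))
    simp only [lowerHalf, inner_root, Set.mem_ofPred_eq, Int.cast_natCast] at h1
    have h2 := (smul_centre_sub_mem_Ioo w hij).1
    have h3 : shiTable w i j < m := by
      have : (shiTable w i j : ℝ) < (m : ℕ) := h2.trans_le h1
      exact_mod_cast this
    have h4 := lt_shiTable_mul w i j
    have h5 := mul_le_mul_of_nonneg_right (Int.add_one_le_iff.2 h3) hn0.le
    rw [add_one_mul] at h5
    linarith
  by_contra hne
  have hpq1 : p + 1 < q := by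
    rcases lt_or_eq_of_le (Int.add_one_le_iff.2 hpq) with h | h
    · exact h
    · exact absurd (by linarith) hne
  obtain ⟨a, c, ha, hwa⟩ := exists_inv_eq w (p + 1)
  obtain ⟨T, hT, hTH⟩ := mem_nhdsWithin_iff_exists_mem_nhds_inter.1 hfr
  have hend : ∀ y : V n, y ∈ hyperplane (root i j) m →
      extend y ((w : Equiv.Perm ℤ) p) = extend y ((w : Equiv.Perm ℤ) q) := by
    intro y hy
    rw [mem_hyperplane_root, Int.cast_natCast] at hy
    have : p = (w : Equiv.Perm ℤ)⁻¹ (j : ℕ) + (-m : ℤ) * n := by rw [hp]; ring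
    rw [this, extend_apply_add_mul, extend_apply_inv, hq, extend_apply_inv]
    push_cast
    linarith
  have hflat : ∀ y : V n, y ∈ T ∩ hyperplane (root i j) m → y.1 a + c = y.1 i := by
    intro y hy
    have hmem := frontier_alcove_subset w (hTH hy)
    have hanti := antitone_of_mem_alcove hmem
    have h1 := hanti (show p ≤ p + 1 by omega)
    have h2 := hanti hpq1.le
    have h3 := hend y hy.2
    have h4 : extend y ((w : Equiv.Perm ℤ) (p + 1)) = y.1 a + c := by
      rw [hwa, show ((a : ℕ) : ℤ) - c * n = (a : ℕ) + (-c) * n by ring, extend_add_mul,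
        extend_natCast]
      push_cast
      ring
    have h5 : extend y ((w : Equiv.Perm ℤ) q) = y.1 i := extend_apply_inv w y i
    simp only at h1 h2
    linarith
  have hxT : x ∈ T ∩ hyperplane (root i j) m := ⟨mem_of_mem_nhds hT, hxH⟩
  have hxA := frontier_alcove_subset w (hTH hxT)
  -- A full period lowers the sequence by one, so values that agree are less than a period apart.
  -- This makes `a` different from `i` below.
  have hqn : q < p + n := by
    by_contra hge
    have h1 := antitone_of_mem_alcove hxA (not_lt.1 hge)
    have h2 := extend_apply_add_mul w x p 1
    simp only [one_mul] at h1 h2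
    have h3 := hend x hxH
    push_cast at h2
    linarith
  have haj : a ≠ j := by
    rintro rfl
    have h1 : (n : ℤ) ∣ 1 := ⟨m - c, by rw [hp] at ha; linear_combination -ha⟩
    have h2 := Int.le_of_dvd one_pos h1
    omega
  have hai : a ≠ i := by
    rintro rfl
    have h1 : (n : ℤ) ∣ q - (p + 1) := ⟨c, by rw [hq, ha]; ring⟩
    have h2 := Int.le_of_dvd (by omega) h1
    omega
  -- The direction `ε_i + ε_j - 2 ε_a` is tangent to the hyperplane but changes `y_a - y_i`, so it
  -- violates the second equation.
  obtain ⟨ε, hε, hεT, -⟩ := eventually_add_smul_mem hT (rootVec i a + rootVec j a)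
  have e1 : ∀ l : Fin n, (x + ε • (rootVec i a + rootVec j a) : V n).1 l = x.1 l +
      ε * ((if l = i then 1 else 0) - (if l = a then 1 else 0) +
        ((if l = j then 1 else 0) - (if l = a then 1 else 0))) := by
    intro l
    simp only [Submodule.coe_add, Submodule.coe_smul, PiLp.add_apply, PiLp.smul_apply,
      rootVec_apply, smul_eq_mul]
  have h1 : x + ε • (rootVec i a + rootVec j a) ∈ hyperplane (root i j) m := by
    rw [mem_hyperplane_root] at hxH ⊢
    rw [e1, e1, ← hxH]
    simp only [hij, hij.symm, hai.symm, haj.symm, if_true, if_false]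
    ring
  have h2 := hflat _ ⟨hεT, h1⟩
  have h3 := hflat x hxT
  rw [e1, e1] at h2
  simp only [hij, hai, hai.symm, haj, if_true, if_false] at h2
  linarith

theorem isCeiling_of_inv_sub_eq (hn : 1 < n) {m : ℕ} (hm : 1 ≤ m) {w : affineSymm n} {i j : Fin n}
    (h : (w : Equiv.Perm ℤ)⁻¹ (j : ℕ) - (w : Equiv.Perm ℤ)⁻¹ (i : ℕ) = m * n - 1) :
    IsCeiling (alcove w) (root i j) m := by
  have hm' : (1 : ℝ) ≤ m := by exact_mod_cast hm
  have hn0 : (0 : ℤ) < n := by exact_mod_cast Nat.pos_of_neZero n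
  have hn1 : (0 : ℝ) < n := by exact_mod_cast Nat.pos_of_neZero n
  have hn2 : (1 : ℤ) < n := by exact_mod_cast hn
  have hij : i ≠ j := by
    rintro rfl
    rw [sub_self] at h
    have h1 : (n : ℤ) ∣ 1 := ⟨m, by linear_combination h⟩
    have h2 := Int.le_of_dvd one_pos h1
    omega
  have hK : shiTable w i j = m - 1 := by
    apply ediv_eq_of_le_of_lt <;> rw [h] <;> linarith
  have hA : ∀ y ∈ alcove w, y.1 i - y.1 j ≤ m := by
    intro y hy
    have := (sub_mem_Icc_of_mem_alcove hy i j).2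
    rw [hK] at this
    push_cast at this
    linarith
  set q := (w : Equiv.Perm ℤ)⁻¹ (i : ℕ) with hq
  have hj : (w : Equiv.Perm ℤ)⁻¹ (j : ℕ) = q - 1 + m * n := by linarith
  have hH : ∀ y : V n, y ∈ hyperplane (root i j) m ↔
      extend y ((w : Equiv.Perm ℤ) (q - 1)) = extend y ((w : Equiv.Perm ℤ) q) := by
    intro y
    have h1 := extend_apply_inv w y j
    rw [hj, extend_apply_add_mul] at h1
    rw [mem_hyperplane_root, hq, extend_apply_inv]
    push_cast at h1 ⊢
    constructor <;> intro h <;> linarith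
  -- The facet point is the midpoint of the centres of the two alcoves `w A_0` and `w s_q A_0`
  -- adjacent across this wall.
  set x : V n := (1 / 2 : ℝ) • (w • centre n) + (1 / 2 : ℝ) • ((w * simple hn q) • centre n)
    with hx
  have hxe : ∀ t : ℤ, extend x ((w : Equiv.Perm ℤ) t) =
      ((n : ℝ) - 1) / (2 * n) - ((t + simpleFun n q t : ℤ) : ℝ) / (2 * n) := by
    intro t
    rw [hx, extend_combo (by norm_num), extend_smul, extend_smul, mul_simple_inv_apply,
      extend_centre, extend_centre]
    simp only [Equiv.Perm.inv_def, Equiv.symm_apply_apply]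
    push_cast
    field_simp
    ring
  have hxH : x ∈ hyperplane (root i j) m := by
    have h1 := simpleFun_left (n := n) q 0
    have h2 := simpleFun_right hn q 0
    simp only [zero_mul, add_zero] at h1 h2
    rw [hH, hxe, hxe, h1, h2]
    ring_nf
  have hxT : ∀ t : ℤ, ¬ t ≡ q - 1 [ZMOD n] →
      extend x ((w : Equiv.Perm ℤ) (t + 1)) < extend x ((w : Equiv.Perm ℤ) t) := by
    intro t ht
    rw [hxe, hxe, sub_lt_sub_iff_left]
    refine div_lt_div_of_pos_right ?_ (by positivity)
    rw [Int.cast_lt]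
    have ht' : ¬ t + 1 ≡ q [ZMOD n] := fun h' => ht (by simpa using h'.sub_right 1)
    unfold simpleFun
    rw [if_neg ht, if_neg ht']
    split_ifs <;> omega
  -- The neighbourhood keeps all defining inequalities strict except those at `t ≡ q - 1`, which
  -- become equalities on the hyperplane.
  refine ⟨⟨x, hxH, mem_nhdsWithin_iff_exists_mem_nhds_inter.2
    ⟨⋂ t : Fin n, {y | ¬ ((t : ℕ) : ℤ) ≡ q - 1 [ZMOD n] →
      extend y ((w : Equiv.Perm ℤ) ((t : ℕ) + 1)) < extend y ((w : Equiv.Perm ℤ) (t : ℕ))},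
      ?_, ?_⟩⟩, ?_, Or.inr ?_⟩
  · refine IsOpen.mem_nhds (isOpen_iInter_of_finite fun t => ?_) (Set.mem_iInter.2 fun t => hxT _)
    by_cases ht : ((t : ℕ) : ℤ) ≡ q - 1 [ZMOD n]
    · simp [ht]
    · simp only [ht, not_false_eq_true, true_imp_iff]
      exact isOpen_lt (continuous_extend _) (continuous_extend _)
  · rintro y ⟨hyT, hyH⟩
    have hyA : y ∈ alcove w := by
      rw [mem_alcove_iff]
      intro t
      obtain ⟨r, k, rfl⟩ := exists_eq_add_mul (n := n) t
      by_cases hr : ((r : ℕ) : ℤ) ≡ q - 1 [ZMOD n]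
      · obtain ⟨l, hl⟩ := hr.dvd
        have e1 : ((r : ℕ) : ℤ) + k * n = q - 1 + (k - l) * n := by linear_combination -hl
        rw [e1, add_right_comm, extend_apply_add_mul, extend_apply_add_mul, sub_add_cancel,
          (hH y).1 hyH]
      · rw [add_right_comm, extend_apply_add_mul, extend_apply_add_mul]
        have := Set.mem_iInter.1 hyT r hr
        linarith
    refine ⟨subset_closure hyA, fun hint => ?_⟩
    have h1 := (sub_mem_Ioo_of_mem_interior hint hij).2
    rw [mem_hyperplane_root.1 hyH, hK] at h1
    push_cast at h1
    linarith
  · rw [mem_hyperplane_root]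
    simp only [ZeroMemClass.coe_zero, PiLp.zero_apply, sub_zero, Int.cast_natCast]
    linarith
  · intro y hy
    simp only [lowerHalf, inner_root, Set.mem_ofPred_eq, Int.cast_natCast]
    rcases hy with rfl | hy
    · simp
    · exact hA y hy

/-! ### Tables of dominant points -/

omit [NeZero n] in
theorem isShiTable_floor {K : Fin n → Fin n → ℤ} {x : Fin n → ℝ}
    (h0 : ∀ a b, a < b → 0 ≤ x a - x b) (hK : ∀ a b, a < b → K a b = ⌊x a - x b⌋) :
    IsShiTable K := by
  refine ⟨fun a b hab => ?_, fun a b c hab hbc => ?_, fun a b c hab hbc => ?_⟩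
  · rw [hK a b hab]
    exact Int.floor_nonneg.2 (h0 a b hab)
  · rw [hK a b hab, hK b c hbc, hK a c (hab.trans hbc), ← sub_add_sub_cancel (x a) (x b) (x c)]
    exact Int.le_floor_add _ _
  · rw [hK a b hab, hK b c hbc, hK a c (hab.trans hbc), ← sub_add_sub_cancel (x a) (x b) (x c)]
    have := Int.le_floor_add_floor (x a - x b) (x b - x c)
    omega

theorem shiTable_eq_floor (w : affineSymm n) {i j : Fin n} (hij : i ≠ j) :
    shiTable w i j = ⌊(w • centre n : V n).1 i - (w • centre n : V n).1 j⌋ := by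
  have h := smul_centre_sub_mem_Ioo w hij
  exact (Int.floor_eq_iff.2 ⟨h.1.le, h.2⟩).symm

theorem IsDominant.sub_nonneg {w : affineSymm n} (hw : IsDominant w) {a b : Fin n} (hab : a < b) :
    0 ≤ (w • centre n : V n).1 a - (w • centre n : V n).1 b := by
  have h := hw (interior_subset (smul_centre_mem_interior w))
  simp only [dominantChamber, upperHalf, Set.mem_iInter, Set.mem_ofPred_eq, inner_root,
    Int.cast_zero, _root_.sub_nonneg] at h
  have key : ∀ d : ℕ, ∀ a b : Fin n, (a : ℕ) + d = b →
      (w • centre n : V n).1 b ≤ (w • centre n : V n).1 a := by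
    intro d
    induction d with
    | zero => intro a b hab; rw [Fin.ext (show (a : ℕ) = b by omega)]
    | succ d ih =>
      intro a b hab
      have hb := b.isLt
      exact (h ⟨a + d, by omega⟩ b (by simp only; omega)).trans (ih a ⟨a + d, by omega⟩ rfl)
  rw [_root_.sub_nonneg]
  rw [Fin.lt_def] at hab
  exact key (b - a) a b (by omega)

theorem IsDominant.isShiTable {w : affineSymm n} (hw : IsDominant w) : IsShiTable (shiTable w) :=
  isShiTable_floor (fun _ _ hab => hw.sub_nonneg hab) fun _ _ hab => shiTable_eq_floor w hab.ne

/-- If no ceiling lies directly above the entry, the index `c` whose value under `w⁻¹` follows that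
of `b` modulo `n` satisfies an exact relation with `a` and `b`. The position of `c` relative to `a <
b` selects the alternative. -/
theorem ceiling_or_isBounded (w : affineSymm n) (a b : Fin n) (hab : a < b) :
    (w : Equiv.Perm ℤ)⁻¹ (b : ℕ) - (w : Equiv.Perm ℤ)⁻¹ (a : ℕ) =
        (shiTable w a b + 1) * n - 1 ∨
      IsBoundedInside (shiTable w) a b ∨ IsBoundedRight (shiTable w) a b ∨
        IsBoundedLeft (shiTable w) a b := by
  by_cases hC : (w : Equiv.Perm ℤ)⁻¹ (b : ℕ) - (w : Equiv.Perm ℤ)⁻¹ (a : ℕ) =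
      (shiTable w a b + 1) * n - 1
  · exact Or.inl hC
  right
  have hn0 : (0 : ℤ) < n := by exact_mod_cast Nat.pos_of_neZero n
  have h1 := shiTable_mul_lt w hab.ne
  have h2 := lt_shiTable_mul w a b
  set K := shiTable w a b with hK
  have h3 : (w : Equiv.Perm ℤ)⁻¹ (b : ℕ) - (w : Equiv.Perm ℤ)⁻¹ (a : ℕ) + 1 < K * n + n := by
    rw [add_one_mul] at hC
    omega
  obtain ⟨c, l, hc, -⟩ := exists_inv_eq w ((w : Equiv.Perm ℤ)⁻¹ (b : ℕ) + 1)
  have hac : shiTable w a c = K + l := by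
    apply ediv_eq_of_le_of_lt <;> rw [hc] <;> linarith
  have hca : c ≠ a := by
    rintro rfl
    have h4 : shiTable w c c = 0 := by simp [shiTable]
    have h5 : K = -l := by omega
    rw [h5] at h1 h3
    linarith
  have hcb : c ≠ b := by
    rintro rfl
    have h4 : l = 0 := by omega
    rw [h4] at hc
    omega
  have hn1 : (1 : ℤ) < n := by linarith
  have hbc : shiTable w b c = l := by
    apply ediv_eq_of_le_of_lt <;> rw [hc] <;> linarith
  have hcb' := shiTable_swap w hcb.symm
  have hca' := shiTable_swap w hca.symm
  rcases lt_or_gt_of_ne hca with h | h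
  · exact Or.inr (Or.inr ⟨c, h, by omega⟩)
  · rcases lt_or_gt_of_ne hcb with h' | h'
    · exact Or.inl ⟨c, h, h', by omega⟩
    · exact Or.inr (Or.inl ⟨c, h', by omega⟩)

theorem exists_crossing (hn : 1 < n) (w : affineSymm n) {a b : Fin n}
    (h : (w : Equiv.Perm ℤ)⁻¹ (b : ℕ) - (w : Equiv.Perm ℤ)⁻¹ (a : ℕ) =
      (shiTable w a b + 1) * n - 1) :
    ∃ w' : affineSymm n, shiTable w' a b = shiTable w a b + 1 ∧
      shiTable w' b a = shiTable w b a - 1 ∧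
      ∀ p q : Fin n, ¬ (p = a ∧ q = b) → ¬ (p = b ∧ q = a) →
        shiTable w' p q = shiTable w p q := by
  -- The generator is `s_q` with `q = w⁻¹ a`. The value at `b` is congruent to `q - 1`, so `b` takes
  -- the first role and `a` the second.
  obtain ⟨h1, h2, h3⟩ := shiTable_mul_simple hn w (i := (w : Equiv.Perm ℤ)⁻¹ (a : ℕ))
    (c := shiTable w a b + 1) (d := 0) (a := b) (b := a) (by linarith) (by ring)
  exact ⟨_, h2, h1, fun p q hp hq => h3 p q hq hp⟩

/-! ### The finite symmetric group -/

theorem finEmb_inv_apply (ρ : Equiv.Perm (Fin n)) (a : Fin n) :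
    ((finEmb ρ : affineSymm n) : Equiv.Perm ℤ)⁻¹ ((ρ a : Fin n) : ℕ) = (a : ℕ) := by
  rw [Equiv.Perm.inv_def, Equiv.symm_apply_eq]
  change _ = ((ρ (res n ((a : ℕ) : ℤ)) : ℕ) : ℤ) + ((a : ℕ) : ℤ) / n * n
  rw [res_natCast, Int.ediv_eq_zero_of_lt (by positivity) (by exact_mod_cast a.isLt)]
  ring

theorem finEmb_smul_apply (ρ : Equiv.Perm (Fin n)) (y : V n) (a : Fin n) :
    (finEmb ρ • y : V n).1 (ρ a) = y.1 a := by
  rw [← extend_natCast (finEmb ρ • y), extend_smul, finEmb_inv_apply, extend_natCast]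

theorem shiTable_finEmb_mul (ρ : Equiv.Perm (Fin n)) (w : affineSymm n) (a b : Fin n) :
    shiTable (finEmb ρ * w) (ρ a) (ρ b) = shiTable w a b := by
  have h : ∀ a : Fin n, ((finEmb ρ * w : affineSymm n) : Equiv.Perm ℤ)⁻¹ ((ρ a : Fin n) : ℕ) =
      (w : Equiv.Perm ℤ)⁻¹ (a : ℕ) := fun a => by
    rw [Subgroup.coe_mul, mul_inv_rev, Equiv.Perm.mul_apply, finEmb_inv_apply]
  rw [shiTable, h, h, shiTable]

theorem finEmb_one : (finEmb (1 : Equiv.Perm (Fin n)) : affineSymm n) = 1 := by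
  refine Subtype.ext (Equiv.ext fun x => ?_)
  change ((res n x : ℕ) : ℤ) + x / n * n = x
  rw [res_val, mul_comm, Int.emod_add_mul_ediv]

/-- A pair reversed by `ρ` contributes `|-1 - k| = k + 1`, which increases with `k ≥ 0` just as
`|k|` does. An entrywise comparison therefore suffices whatever `ρ` is. -/
theorem separation_le_finEmb_mul (ρ : Equiv.Perm (Fin n)) {w w' : affineSymm n}
    (h : ∀ a b : Fin n, a < b → 0 ≤ shiTable w' (ρ a) (ρ b) ∧
      shiTable w' (ρ a) (ρ b) ≤ shiTable w a b) :
    separation w' ≤ separation (finEmb ρ * w) := by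
  refine Finset.sum_le_sum fun p hp => ?_
  rw [Finset.mem_filter] at hp
  obtain ⟨i, j⟩ := p
  obtain ⟨a, rfl⟩ := ρ.surjective i
  obtain ⟨b, rfl⟩ := ρ.surjective j
  simp only [shiTable_finEmb_mul]
  have hab : a ≠ b := fun e => hp.2.ne (by rw [e])
  rcases lt_or_gt_of_ne hab with hlt | hlt
  · have := h a b hlt
    omega
  · have := h b a hlt
    have h1 := shiTable_swap w hab.symm
    have h2 := shiTable_swap w' hp.2.ne'
    simp only at h1 h2
    omega

theorem separation_lt_finEmb_mul (ρ : Equiv.Perm (Fin n)) {w w' : affineSymm n}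
    (h : ∀ a b : Fin n, a < b → 0 ≤ shiTable w a b ∧ shiTable w a b ≤ shiTable w' a b)
    {a b : Fin n} (hab : a < b) (hlt : shiTable w a b < shiTable w' a b) :
    separation (finEmb ρ * w) < separation (finEmb ρ * w') := by
  refine Finset.sum_lt_sum (fun p hp => ?_) ?_
  · rw [Finset.mem_filter] at hp
    obtain ⟨i, j⟩ := p
    obtain ⟨c, rfl⟩ := ρ.surjective i
    obtain ⟨d, rfl⟩ := ρ.surjective j
    simp only [shiTable_finEmb_mul]
    have hcd : c ≠ d := fun e => hp.2.ne (by rw [e])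
    rcases lt_or_gt_of_ne hcd with hlt | hlt
    · have := h c d hlt
      omega
    · have := h d c hlt
      have h1 := shiTable_swap w hcd.symm
      have h2 := shiTable_swap w' hcd.symm
      omega
  · have hab' := h a b hab
    rcases lt_or_gt_of_ne (fun e => hab.ne (ρ.injective e) : ρ a ≠ ρ b) with h1 | h1
    · refine ⟨(ρ a, ρ b), by simpa using h1, ?_⟩
      simp only [shiTable_finEmb_mul]
      omega
    · refine ⟨(ρ b, ρ a), by simpa using h1, ?_⟩
      simp only [shiTable_finEmb_mul]
      have h2 := shiTable_swap w hab.ne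
      have h3 := shiTable_swap w' hab.ne
      omega

/-! ### Maximal alcoves -/

/-- Otherwise crossing the ceiling and then applying `ρ` gives a longer element in the same region.
-/
theorem shiTable_lt_of_isMaximal (hn : 1 < n) {m : ℕ} {w : affineSymm n} (hdom : IsDominant w)
    (ρ : Equiv.Perm (Fin n)) (hmax : IsMaximal m (finEmb ρ * w)) {a b : Fin n} (hab : a < b)
    (h : (w : Equiv.Perm ℤ)⁻¹ (b : ℕ) - (w : Equiv.Perm ℤ)⁻¹ (a : ℕ) =
      (shiTable w a b + 1) * n - 1) :
    shiTable w a b < m ∧ (shiTable w a b = m - 1 → ρ a < ρ b) := by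
  by_contra hcon
  have hcase : (m : ℤ) ≤ shiTable w a b ∨ (shiTable w a b = m - 1 ∧ ρ b < ρ a) := by
    by_contra! h'
    refine hcon ⟨h'.1, fun e => lt_of_le_of_ne (h'.2 e) fun e' => hab.ne (ρ.injective e')⟩
  have hK := hdom.isShiTable
  obtain ⟨w', h1, h2, h3⟩ := exists_crossing hn w h
  have hswap := shiTable_swap w hab.ne
  have hle : ∀ c d : Fin n, c < d → 0 ≤ shiTable w c d ∧ shiTable w c d ≤ shiTable w' c d := by
    intro c d hcd
    refine ⟨hK.nonneg c d hcd, ?_⟩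
    by_cases hc : c = a ∧ d = b
    · rw [hc.1, hc.2, h1]
      omega
    · rw [h3 c d hc]
      rintro ⟨rfl, rfl⟩
      exact lt_asymm hab hcd
  have hsep := separation_lt_finEmb_mul ρ hle hab (by omega)
  refine absurd (((isMaximal_iff hn).1 hmax).2 _ ?_) (not_le.2 hsep)
  refine sameRegion_of_mem_Ioo (fun _ _ hij => smul_centre_sub_mem_Ioo _ hij.ne)
    (fun _ _ hij => smul_centre_sub_mem_Ioo _ hij.ne) ?_
  intro i j hij k hk1 hk2
  obtain ⟨c, rfl⟩ := ρ.surjective i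
  obtain ⟨d, rfl⟩ := ρ.surjective j
  rw [shiTable_finEmb_mul, shiTable_finEmb_mul]
  -- In the original order both entries are at least `m`. In the reversed order the entry drops from
  -- `-1 - K` to `-2 - K` with `K ≥ m - 1`, so both are at most `-m`. No level `k` with `-m < k ≤ m`
  -- distinguishes them in either case.
  by_cases hc : c = a ∧ d = b
  · obtain ⟨rfl, rfl⟩ := hc
    have : (m : ℤ) ≤ shiTable w c d := hcase.resolve_right fun e => lt_asymm hij e.2
    omega
  by_cases hc' : c = b ∧ d = a
  · obtain ⟨rfl, rfl⟩ := hc'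
    omega
  rw [h3 c d hc hc']

/-- For `m = 0` every entry is at least `m`, so all pairs would split. Adjacent indices have nothing
between them. -/
theorem one_le_of_isMaximal (hn : 1 < n) {m : ℕ} {w : affineSymm n} (hdom : IsDominant w)
    (hC : ∀ a b : Fin n, a < b → (w : Equiv.Perm ℤ)⁻¹ (b : ℕ) - (w : Equiv.Perm ℤ)⁻¹ (a : ℕ) =
      (shiTable w a b + 1) * n - 1 → shiTable w a b < m) : 1 ≤ m := by
  by_contra hm
  have hm0 : m = 0 := by omega
  subst hm0
  have h01 : (⟨0, by omega⟩ : Fin n) < ⟨1, hn⟩ := by simp [Fin.lt_def]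
  obtain ⟨c, h1, h2, -⟩ := hdom.isShiTable.isBoundedInside (ceiling_or_isBounded w) hC _ _ h01
    (by simpa using hdom.isShiTable.nonneg _ _ h01)
  rw [Fin.lt_def] at h1 h2
  simp only at h1 h2
  omega

/-- Since `m ≥ 1`, the hyperplanes through the origin belong to the arrangement, so `y` moved back
by `ρ` is again dominant and its floors form a Shi table. The region fixes the upper bounds for
entries below `m - 1`, and also at `m - 1` when `ρ` preserves the order of the pair; the ceilings
supply the rest. -/
theorem floor_le_of_sameRegion {m : ℕ} (hm : 1 ≤ m) {w : affineSymm n}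
    (hdom : IsDominant w) {ρ : Equiv.Perm (Fin n)}
    (hC : ∀ a b : Fin n, a < b → (w : Equiv.Perm ℤ)⁻¹ (b : ℕ) - (w : Equiv.Perm ℤ)⁻¹ (a : ℕ) =
      (shiTable w a b + 1) * n - 1 →
        shiTable w a b < m ∧ (shiTable w a b = m - 1 → ρ a < ρ b))
    {y : V n} (hy : SameRegion m ((finEmb ρ * w) • centre n) y) (a b : Fin n) (hab : a < b) :
    0 ≤ y.1 (ρ a) - y.1 (ρ b) ∧ ⌊y.1 (ρ a) - y.1 (ρ b)⌋ ≤ shiTable w a b := by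
  have hK := hdom.isShiTable
  have hx : ∀ a b : Fin n, a < b →
      ((finEmb ρ * w) • centre n : V n).1 (ρ a) - ((finEmb ρ * w) • centre n : V n).1 (ρ b) ∈
        Set.Ioo (shiTable w a b : ℝ) (shiTable w a b + 1) := by
    intro a b hab
    rw [mul_smul, finEmb_smul_apply, finEmb_smul_apply]
    exact smul_centre_sub_mem_Ioo w hab.ne
  have hne : ∀ a b : Fin n, a < b → ρ a ≠ ρ b := fun a b hab e => hab.ne (ρ.injective e)
  have h0 : ∀ a b : Fin n, a < b → 0 ≤ y.1 (ρ a) - y.1 (ρ b) := by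
    intro a b hab
    have h1 := (hx a b hab).1
    have h2 : (0 : ℝ) ≤ shiTable w a b := by exact_mod_cast hK.nonneg a b hab
    rcases lt_or_gt_of_ne (hne a b hab) with h | h
    · rcases hy _ _ h 0 (by omega) (by omega) with h' | h' <;> push_cast at h' <;> linarith
    · rcases hy _ _ h 0 (by omega) (by omega) with h' | h' <;> push_cast at h' <;> linarith
  have hup : ∀ a b : Fin n, a < b → ρ a < ρ b → shiTable w a b < m →
      ⌊y.1 (ρ a) - y.1 (ρ b)⌋ ≤ shiTable w a b := by
    intro a b hab h hlt
    have h1 := (hx a b hab).2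
    have h2 := hK.nonneg a b hab
    rw [← Int.lt_add_one_iff, Int.floor_lt]
    rcases hy _ _ h (shiTable w a b + 1) (by omega) (by omega) with h' | h' <;>
      push_cast at h' ⊢ <;> linarith
  refine ⟨h0 a b hab, hK.le_of_le_at_ceilings (L := fun a b => ⌊y.1 (ρ a) - y.1 (ρ b)⌋) (m := m)
    (isShiTable_floor (x := fun a => y.1 (ρ a)) h0 fun _ _ _ => rfl) (ceiling_or_isBounded w)
    (fun a b hab h => (hC a b hab h).1) ?_ ?_ a b hab⟩
  · intro a b hab hlt
    rcases lt_or_gt_of_ne (hne a b hab) with h | h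
    · exact hup a b hab h (by omega)
    · have h1 := (hx a b hab).2
      have h2 := hK.nonneg a b hab
      rw [← Int.lt_add_one_iff, Int.floor_lt]
      -- For a reversed pair the relevant level is `-(K + 1)`, which exceeds `-m` only because `K <
      -- m - 1`.
      rcases hy _ _ h (-(shiTable w a b + 1)) (by omega) (by omega) with h' | h' <;>
        push_cast at h' ⊢ <;> linarith
  · intro a b hab h he
    exact hup a b hab ((hC a b hab h).2 he) (by omega)

omit [NeZero n] in
-- Coordinates sum to zero, so `n y_i` is the sum of the differences `y_i - y_j`.
theorem isBounded_of_abs_sub_le {S : Set (V n)} {M : ℝ}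
    (h : ∀ y ∈ S, ∀ i j : Fin n, |y.1 i - y.1 j| ≤ M) : Bornology.IsBounded S := by
  rw [isBounded_iff_forall_norm_le]
  refine ⟨√(∑ _i : Fin n, M ^ 2), fun y hy => ?_⟩
  rw [← Submodule.norm_coe, EuclideanSpace.norm_eq]
  refine Real.sqrt_le_sqrt (Finset.sum_le_sum fun i _ => ?_)
  have hn : (0 : ℝ) < n := by exact_mod_cast (Nat.zero_le _).trans_lt i.isLt
  have hsum : ∑ j, y.1 j = 0 := y.2
  have h1 : n * y.1 i = ∑ j : Fin n, (y.1 i - y.1 j) := by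
    simp [Finset.sum_sub_distrib, hsum]
  have h2 : |n * y.1 i| ≤ n * M := by
    rw [h1]
    refine (Finset.abs_sum_le_sum_abs _ _).trans ?_
    refine (Finset.sum_le_sum fun j _ => h y hy i j).trans ?_
    simp
  rw [abs_mul, abs_of_pos hn] at h2
  rw [Real.norm_eq_abs]
  exact pow_le_pow_left₀ (abs_nonneg _) (le_of_mul_le_mul_left h2 hn) 2

theorem isMaximal_finEmb_mul (hn : 1 < n) {m : ℕ} (hm : 1 ≤ m) {w : affineSymm n}
    (hdom : IsDominant w) {ρ : Equiv.Perm (Fin n)}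
    (hC : ∀ a b : Fin n, a < b → (w : Equiv.Perm ℤ)⁻¹ (b : ℕ) - (w : Equiv.Perm ℤ)⁻¹ (a : ℕ) =
      (shiTable w a b + 1) * n - 1 →
        shiTable w a b < m ∧ (shiTable w a b = m - 1 → ρ a < ρ b)) :
    IsMaximal m (finEmb ρ * w) := by
  have key := fun y => floor_le_of_sameRegion (y := y) hm hdom hC
  rw [isMaximal_iff hn]
  refine ⟨?_, fun w' hw' => separation_le_finEmb_mul ρ fun a b hab => ?_⟩
  · obtain ⟨M, hM⟩ := Set.finite_range (fun p : Fin n × Fin n => shiTable w p.1 p.2) |>.bddAbove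
    refine isBounded_of_abs_sub_le (M := M + 1) fun y hy i j => ?_
    have hlt : ∀ a b : Fin n, a < b → |y.1 (ρ a) - y.1 (ρ b)| ≤ M + 1 := by
      intro a b hab
      obtain ⟨h1, h2⟩ := key y hy a b hab
      have h3 : ⌊y.1 (ρ a) - y.1 (ρ b)⌋ ≤ M := h2.trans (hM ⟨(a, b), rfl⟩)
      rw [abs_of_nonneg h1]
      have h4 : (⌊y.1 (ρ a) - y.1 (ρ b)⌋ : ℝ) ≤ M := by exact_mod_cast h3
      linarith [Int.lt_floor_add_one (y.1 (ρ a) - y.1 (ρ b))]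
    have h0 : (0 : ℝ) ≤ M + 1 := (abs_nonneg _).trans
      (hlt ⟨0, by omega⟩ ⟨1, hn⟩ (by simp [Fin.lt_def]))
    obtain ⟨a, rfl⟩ := ρ.surjective i
    obtain ⟨b, rfl⟩ := ρ.surjective j
    rcases lt_trichotomy a b with h | rfl | h
    · exact hlt a b h
    · simpa using h0
    · rw [abs_sub_comm]
      exact hlt b a h
  · obtain ⟨h1, h2⟩ := key _ hw' a b hab
    rw [shiTable_eq_floor w' fun e => hab.ne (ρ.injective e)]
    exact ⟨Int.floor_nonneg.2 h1, h2⟩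

end ShiAlcove

end

/-! ### The equivalence -/

theorem mainTheorem4 (n : ℕ) [NeZero n] (hn : 2 < n) (m : ℕ)
    (w : ShiAlcove.affineSymm n) (hdom : ShiAlcove.IsDominant w)
    (hmax : ShiAlcove.IsMaximal m w) (ρ : Equiv.Perm (Fin n)) :
    ShiAlcove.IsMaximal m (ShiAlcove.finEmb ρ * w) ↔
      ρ ∈ ShiAlcove.minimalReps (ShiAlcove.ceilingReflections m w) := by
  have hn1 : 1 < n := by omega
  -- Taking the identity for `ρ` extracts what maximality of `w` itself says: every ceiling has
  -- height at most `m`.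
  have hC := fun (a b : Fin n) (hab : a < b) => ShiAlcove.shiTable_lt_of_isMaximal hn1 hdom 1
    (by rwa [ShiAlcove.finEmb_one, one_mul]) hab
  have hm : 1 ≤ m := ShiAlcove.one_le_of_isMaximal hn1 hdom fun a b hab h => (hC a b hab h).1
  constructor
  · rintro h x ⟨i, j, hij, hceil, rfl⟩
    rw [ShiAlcove.wordLength_lt_mul_swap_iff ρ hij]
    have h1 := ShiAlcove.inv_sub_eq_of_isCeiling hm hij.ne hceil
    have h2 : ShiAlcove.shiTable w i j = m - 1 := by
      have : (1 : ℤ) < n := by exact_mod_cast hn1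
      apply ShiAlcove.ediv_eq_of_le_of_lt <;> rw [h1] <;> linarith
    refine (ShiAlcove.shiTable_lt_of_isMaximal hn1 hdom ρ h hij ?_).2 h2
    rw [h1, h2]
    ring
  · intro h
    refine ShiAlcove.isMaximal_finEmb_mul hn1 hm hdom fun a b hab hab' =>
      ⟨(hC a b hab hab').1, fun he => ?_⟩
    rw [← ShiAlcove.wordLength_lt_mul_swap_iff ρ hab]
    refine h _ ⟨a, b, hab, ShiAlcove.isCeiling_of_inv_sub_eq hn1 hm ?_, rfl⟩
    rw [hab', he]
    ring
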